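/- All varieties are over $\mathbb C$. Let $e_1=(1:0:0:0),\dots,e_4=(0:0:0:1)$, $e_5=(1:1:1:1)$ in $\mathbb P^3$, let $\check{\mathbb P}^3$ be the space of planes of $\mathbb P^3$, and let $U\subset\check{\mathbb P}^3$ be the open set of planes containing none of the $e_i$. The group $\mathcal S_5\subset \mathrm{PGL}(\mathbb P^3)$ of projectivities permuting $e_1,\dots,e_5$ acts on $U$; let $q:U\to M_D:=U/\mathcal S_5$ be the quotient map. A Desargues configuration in a projective plane is the set of ten points and the set of ten lines of Desargues' theorem for two triangles in perspective from a point: the points are the center of perspective, the six vertices and the three intersections of corresponding sides; the lines are the six sides, the three lines joining corresponding vertices, and the axis of perspective; the ten points are required to be pairwise distinct, and so are the ten lines. It is special if one of its lines contains four of its points. Two Desargues configurations are isomorphic if a projective linear isomorphism of their planes maps the points and lines of one onto those of the other. For $\pi\in U$ let $D_\pi$ be the configuration in $\pi$ of the ten points $\overline{e_ie_j}\cap\pi$ and the ten lines $\overline{e_ie_je_k}\cap\pi$. Let $P_{12}\subset U$ be the hyperplane of the planes $\pi\in U$ through the point $Q_{12}=(1:1:0:0)$. **Proposition.** The special Desargues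 configurations are parametrized by the irreducible divisor $q(P_{12})$ in $M_D$. That is: 1. $q(P_{12})$ is a closed irreducible subset of codimension one of $M_D$; 2. for $\pi\in U$, $D_\pi$ is a special Desargues configuration if and only if $q(\pi)\in q(P_{12})$; 3. every special Desargues configuration in $\mathbb P^2$ is isomorphic to $D_\pi$ for some $\pi\in P_{12}$; 4. for $\pi,\pi'\in P_{12}$, $D_\pi$ is isomorphic to $D_{\pi'}$ if and only if $q(\pi)=q(\pi')$. -/

import Mathlib

open scoped LinearAlgebra.Projectivization

noncomputable section

namespace DesarguesModuli

/-! ### Configurations in a projective plane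

The points and lines of the projective plane `ℙ(W)` of a three-dimensional complex vector space `W`
are the one- and two-dimensional linear subspaces of `W`; incidence is `≤`, the line joining two
points is `⊔`, and the intersection of two lines is `⊓`. -/

/-- A set of points and a set of lines of `ℙ(W)`, both without any labelling. -/
structure Configuration (W : Type) [AddCommGroup W] [Module ℂ W] where
  points : Set (Submodule ℂ W)
  lines : Set (Submodule ℂ W)

namespace Configuration

variable {W W' : Type} [AddCommGroup W] [Module ℂ W] [AddCommGroup W'] [Module ℂ W']

/-- The intersection of the sides `A i A j` and `B i B j` of the triangles `A` and `B`. -/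
def sideMeet (A B : Fin 3 → Submodule ℂ W) (i j : Fin 3) : Submodule ℂ W :=
  (A i ⊔ A j) ⊓ (B i ⊔ B j)

/-- `D` is a Desargues configuration: there are two (nondegenerate) triangles `A`, `B` in
perspective from a point `O`, such that `D` consists of the ten points: `O`, the six vertices, the
three intersections of corresponding sides, and of the ten lines: the six sides, the three lines
through `O` joining corresponding vertices, and the axis, which is spanned by the intersections of
corresponding sides.

The conditions that corresponding vertices differ and that `O` is on no side of the two triangles
say that the ten points and the ten lines are pairwise distinct. A vertex of one triangle may lie on
the opposite side of the other one. -/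
def IsDesargues (D : Configuration W) : Prop :=
  Module.finrank ℂ W = 3 ∧
  ∃ (O : Submodule ℂ W) (A B : Fin 3 → Submodule ℂ W),
    Module.finrank ℂ O = 1 ∧
    (∀ i, Module.finrank ℂ (A i) = 1) ∧ (∀ i, Module.finrank ℂ (B i) = 1) ∧
    A 0 ⊔ A 1 ⊔ A 2 = ⊤ ∧ B 0 ⊔ B 1 ⊔ B 2 = ⊤ ∧
    (∀ i, A i ≠ B i) ∧
    (∀ i, O ≤ A i ⊔ B i) ∧
    (∀ i j, i ≠ j → ¬ O ≤ A i ⊔ A j) ∧ (∀ i j, i ≠ j → ¬ O ≤ B i ⊔ B j) ∧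
    D.points = {O} ∪ Set.range A ∪ Set.range B ∪ {p | ∃ i j, i ≠ j ∧ p = sideMeet A B i j} ∧
    D.lines = {l | ∃ i j, i ≠ j ∧ l = A i ⊔ A j} ∪ {l | ∃ i j, i ≠ j ∧ l = B i ⊔ B j} ∪
      {l | ∃ i, l = A i ⊔ B i} ∪ {sideMeet A B 0 1 ⊔ sideMeet A B 0 2 ⊔ sideMeet A B 1 2}

/-- `D` is a special Desargues configuration: it is a Desargues configuration, and one of its lines
contains four of its points. -/
def IsSpecialDesargues (D : Configuration W) : Prop :=
  D.IsDesargues ∧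
    ∃ l ∈ D.lines, ∃ s : Finset (Submodule ℂ W), s.card = 4 ∧ ∀ p ∈ s, p ∈ D.points ∧ p ≤ l

/-- Two configurations are isomorphic if a projective linear isomorphism between the planes in which
they lie (an element of the projective linear group if the planes are equal) maps the points and the
lines of the first onto those of the second. -/
def Iso (D : Configuration W) (D' : Configuration W') : Prop :=
  ∃ φ : W ≃ₗ[ℂ] W',
    D'.points = Submodule.map (φ : W →ₗ[ℂ] W') '' D.points ∧
    D'.lines = Submodule.map (φ : W →ₗ[ℂ] W') '' D.lines

end Configuration

/-! ### The dual projective space with its Zariski topology -/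

/-- The dual of `ℙ³`: the class of `(α₁, α₂, α₃, α₄)` is the plane `∑ αᵢ xᵢ = 0`. -/
def DualSpace : Type := ℙ ℂ (Fin 4 → ℂ)

namespace DualSpace

/-- Homogeneous coordinates of a plane. -/
def coord (α : DualSpace) : Fin 4 → ℂ := Projectivization.rep (K := ℂ) (V := Fin 4 → ℂ) α

/-- The plane `∑ αᵢ xᵢ = 0` in `ℙ³`, as a linear subspace of `ℂ⁴`. -/
def plane (α : DualSpace) : Submodule ℂ (Fin 4 → ℂ) :=
  LinearMap.ker (∑ i, α.coord i • (LinearMap.proj i : (Fin 4 → ℂ) →ₗ[ℂ] ℂ))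

/-- The common zeros of a set of polynomials (used for homogeneous polynomials only). -/
def zeroLocus (S : Set (MvPolynomial (Fin 4) ℂ)) : Set DualSpace :=
  {α | ∀ f ∈ S, MvPolynomial.eval α.coord f = 0}

/-- The sets of common zeros of homogeneous polynomials. -/
def zariskiClosed : Set (Set DualSpace) :=
  {Z | ∃ S : Set (MvPolynomial (Fin 4) ℂ), (∀ f ∈ S, ∃ d : ℕ, f.IsHomogeneous d) ∧ Z = zeroLocus S}

theorem empty_mem_zariskiClosed : ∅ ∈ zariskiClosed := by
  refine ⟨{1}, ?_, ?_⟩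
  · rintro f rfl
    exact ⟨0, MvPolynomial.isHomogeneous_one _ _⟩
  · ext α
    simp [zeroLocus]

theorem sInter_mem_zariskiClosed (T : Set (Set DualSpace)) (hT : T ⊆ zariskiClosed) :
    ⋂₀ T ∈ zariskiClosed := by
  refine ⟨{f | (∃ d : ℕ, f.IsHomogeneous d) ∧ ∀ α ∈ ⋂₀ T, MvPolynomial.eval α.coord f = 0},
    fun f hf => hf.1, ?_⟩
  ext α
  constructor
  · intro hα f hf
    exact hf.2 α hα
  · intro hα Z hZ
    obtain ⟨S, hS, rfl⟩ := hT hZ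
    intro f hf
    exact hα f ⟨hS f hf, fun β hβ => hβ _ hZ f hf⟩

theorem union_mem_zariskiClosed (Y : Set DualSpace) (hY : Y ∈ zariskiClosed) (Z : Set DualSpace)
    (hZ : Z ∈ zariskiClosed) : Y ∪ Z ∈ zariskiClosed := by
  obtain ⟨S, hS, rfl⟩ := hY
  obtain ⟨T, hT, rfl⟩ := hZ
  refine ⟨{h | ∃ f ∈ S, ∃ g ∈ T, h = f * g}, ?_, ?_⟩
  · rintro h ⟨f, hf, g, hg, rfl⟩
    obtain ⟨a, ha⟩ := hS f hf
    obtain ⟨b, hb⟩ := hT g hg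
    exact ⟨a + b, ha.mul hb⟩
  · ext α
    constructor
    · rintro (hα | hα) h ⟨f, hf, g, hg, rfl⟩
      · simp [hα f hf]
      · simp [hα g hg]
    · intro hα
      by_contra hne
      simp only [Set.mem_union, not_or, zeroLocus, Set.mem_ofPred_eq, not_forall] at hne
      obtain ⟨⟨f, hf, hf0⟩, g, hg, hg0⟩ := hne
      have := hα (f * g) ⟨f, hf, g, hg, rfl⟩
      rw [map_mul] at this
      exact (mul_ne_zero hf0 hg0) this

/-- The Zariski topology. -/
instance : TopologicalSpace DualSpace :=
  TopologicalSpace.ofClosed zariskiClosed empty_mem_zariskiClosed sInter_mem_zariskiClosed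
    union_mem_zariskiClosed

end DualSpace

/-! ### The moduli space of Desargues configurations -/

/-- Vectors representing the points `e₁ = (1:0:0:0)`, …, `e₄ = (0:0:0:1)`, `e₅ = (1:1:1:1)`. -/
def frameVec : Fin 5 → Fin 4 → ℂ :=
  ![![1, 0, 0, 0], ![0, 1, 0, 0], ![0, 0, 1, 0], ![0, 0, 0, 1], ![1, 1, 1, 1]]

/-- The point `eᵢ` of `ℙ³`. -/
def frame (i : Fin 5) : Submodule ℂ (Fin 4 → ℂ) := Submodule.span ℂ {frameVec i}

/-- The open set `U` of planes that contain none of the points `eᵢ`, with the topology induced from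
the Zariski topology of the dual projective space. -/
abbrev U : Type := {α : DualSpace // ∀ i, ¬ frame i ≤ α.plane}

/-- The group of linear automorphisms of `ℂ⁴` that permute the points `e₁, …, e₅` of `ℙ³`. Modulo
the scalars, which act trivially on `ℙ³`, it is the subgroup `𝒮₅` of the projective linear group
of `ℙ³` that consists of the projectivities permuting the `eᵢ`. -/
def frameGroup : Subgroup ((Fin 4 → ℂ) ≃ₗ[ℂ] (Fin 4 → ℂ)) where
  carrier := {A | ∃ σ : Equiv.Perm (Fin 5), ∀ i,
    Submodule.map (A : (Fin 4 → ℂ) →ₗ[ℂ] (Fin 4 → ℂ)) (frame i) = frame (σ i)}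
  one_mem' := ⟨1, fun i => Submodule.map_id (frame i)⟩
  mul_mem' := by
    rintro A B ⟨σ, hσ⟩ ⟨τ, hτ⟩
    refine ⟨σ * τ, fun i => ?_⟩
    rw [Equiv.Perm.mul_apply, ← hσ, ← hτ, ← Submodule.map_comp]
    rfl
  inv_mem' := by
    rintro A ⟨σ, hσ⟩
    refine ⟨σ⁻¹, fun i => ?_⟩
    have h : Submodule.map (A : (Fin 4 → ℂ) →ₗ[ℂ] (Fin 4 → ℂ)) (frame (σ⁻¹ i)) = frame i :=
      (hσ (σ⁻¹ i)).trans (congrArg frame (σ.apply_symm_apply i))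
    rw [← h, ← Submodule.map_comp]
    convert Submodule.map_id _
    exact LinearMap.ext fun x => A.symm_apply_apply x

/-- Two planes of `U` are in the same `𝒮₅`-orbit. -/
def orbitSetoid : Setoid U where
  r α β := ∃ A ∈ frameGroup,
    Submodule.map (A : (Fin 4 → ℂ) →ₗ[ℂ] (Fin 4 → ℂ)) α.1.plane = β.1.plane
  iseqv :=
    { refl := fun α => ⟨1, one_mem _, Submodule.map_id _⟩
      symm := by
        rintro α β ⟨A, hA, h⟩
        refine ⟨A⁻¹, inv_mem hA, ?_⟩
        rw [← h, ← Submodule.map_comp]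
        convert Submodule.map_id _
        exact LinearMap.ext fun x => A.symm_apply_apply x
      trans := by
        rintro α β γ ⟨A, hA, h⟩ ⟨B, hB, h'⟩
        refine ⟨B * A, mul_mem hB hA, ?_⟩
        rw [← h', ← h, ← Submodule.map_comp]
        rfl }

/-- The moduli space `M_D = U / 𝒮₅`. Its topology is the quotient topology, which is the Zariski
topology of the quotient variety, because the quotient by a finite group is a geometric one. -/
def ModuliSpace : Type := Quotient orbitSetoid

instance : TopologicalSpace ModuliSpace := inferInstanceAs (TopologicalSpace (Quotient orbitSetoid))

/-- The quotient map `q : U → M_D`. -/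
def q (α : U) : ModuliSpace := Quotient.mk orbitSetoid α

/-- The Desargues configuration that the ten lines `eᵢeⱼ` and the ten planes `eᵢeⱼeₖ` of `ℙ³` cut
out on the plane `α`. -/
def desargues (α : U) : Configuration α.1.plane where
  points := {p | ∃ i j : Fin 5, i ≠ j ∧
    p = Submodule.comap α.1.plane.subtype (frame i ⊔ frame j)}
  lines := {l | ∃ i j k : Fin 5, i ≠ j ∧ i ≠ k ∧ j ≠ k ∧
    l = Submodule.comap α.1.plane.subtype (frame i ⊔ frame j ⊔ frame k)}

/-- The hyperplane `P₁₂` of `U`: the planes through `Q₁₂ = (1:1:0:0)`. -/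
def P12 : Set U := {α | Submodule.span ℂ {(![1, 1, 0, 0] : Fin 4 → ℂ)} ≤ α.1.plane}

/-- `Z` is an irreducible (prime) divisor of the variety `X`: a closed irreducible subset of
codimension one. -/
def IsIrreducibleDivisor {X : Type} [TopologicalSpace X] (Z : Set X) : Prop :=
  ∃ Y : TopologicalSpace.IrreducibleCloseds X, (Y : Set X) = Z ∧ Order.coheight Y = 1

end DesarguesModuli

end

/-! Everything is encoded in five numbers. Rescale vectors representing the `eᵢ` so that they sum to
zero (`circVec`), and let `sᵢ` be the value at the i-th vector of a linear form defining the plane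
`π`. The `sᵢ` have sum zero, are determined up to a common scalar, and are all nonzero exactly when
`π` lies in `U`. Dividing the i-th vector by `sᵢ` gives five points of an affine 3-space with `π` as
its plane at infinity and with the affine relation `∑ sᵢ xᵢ = 0`. Then `D_π` consists of the
directions of the lines and planes spanned by these points. Such a system of points is a pentad
(`IsPentad`).

Conversely, every Desargues configuration comes from a pentad (`exists_pentad`). Index its points
and lines by pairs of indices, the line of `b` being spanned by the three indices outside `b`. The
point of `a` lies on the line of `b` iff `a` and `b` are disjoint, or `a = b = {i, j}` and `sᵢ + sⱼ
= 0` (`flat_le_flat_compl_iff`). So the configuration is special iff two coefficients cancel, and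
since cancelling pairs always meet, the extra incidences do not disturb the combinatorics. Every
isomorphism therefore permutes the five indices and carries the relation along: isomorphism classes
are the vectors `s` up to permutation and scalar (`iso_iff`). The orbits of planes have the same
description (`q_eq_iff`), and `P₁₂` is the locus `s₁ + s₂ = 0`.

For the divisor, the preimage of `q(P₁₂)` is a finite union of hyperplanes, and `q(P₁₂)` is the
image of an irreducible one. An irreducible closed set strictly between `q(P₁₂)` and `M_D` is
excluded by removing all factors `X₀ + X₁` from an equation vanishing on its preimage
(`eq_or_eq_univ_of_image_P12_subset`). -/

noncomputable section

namespace DesarguesModuli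

/-! ### Pentads: five affine points and their directions -/

section Pentad

variable {W W' : Type} [AddCommGroup W] [Module ℂ W] [AddCommGroup W'] [Module ℂ W']

/-- The directions of the affine span of the points `x i`, `i ∈ T`. -/
def flat (x : Fin 5 → W) (T : Finset (Fin 5)) : Submodule ℂ W where
  carrier := {v | ∃ t : Fin 5 → ℂ, ∑ i, t i = 0 ∧ (∀ i, i ∉ T → t i = 0) ∧ ∑ i, t i • x i = v}
  zero_mem' := ⟨0, by simp⟩
  add_mem' := by
    rintro _ _ ⟨t, ht, ht', rfl⟩ ⟨u, hu, hu', rfl⟩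
    refine ⟨t + u, by simp [Finset.sum_add_distrib, ht, hu], fun i hi => ?_, ?_⟩
    · simp [ht' i hi, hu' i hi]
    · simp [add_smul, Finset.sum_add_distrib]
  smul_mem' := by
    rintro c _ ⟨t, ht, ht', rfl⟩
    refine ⟨c • t, by simp [← Finset.mul_sum, ht], fun i hi => by simp [ht' i hi], ?_⟩
    simp [mul_smul, Finset.smul_sum]

theorem mem_flat {x : Fin 5 → W} {T : Finset (Fin 5)} {v : W} :
    v ∈ flat x T ↔ ∃ t : Fin 5 → ℂ, ∑ i, t i = 0 ∧ (∀ i, i ∉ T → t i = 0) ∧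
      ∑ i, t i • x i = v := Iff.rfl

theorem flat_mono (x : Fin 5 → W) {T T' : Finset (Fin 5)} (h : T ⊆ T') : flat x T ≤ flat x T' := by
  rintro _ ⟨t, ht, ht', rfl⟩
  exact ⟨t, ht, fun i hi => ht' i fun hi' => hi (h hi'), rfl⟩

theorem sub_mem_flat (x : Fin 5 → W) {T : Finset (Fin 5)} {i j : Fin 5} (hi : i ∈ T) (hj : j ∈ T) :
    x i - x j ∈ flat x T := by
  refine ⟨Pi.single i 1 - Pi.single j 1, by simp, fun k hk => ?_, ?_⟩
  · have h1 : k ≠ i := fun h => hk (h ▸ hi)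
    have h2 : k ≠ j := fun h => hk (h ▸ hj)
    simp [h1, h2]
  · simp [sub_smul, Finset.sum_sub_distrib, Pi.single_apply, ite_smul]

/-- Coefficients on the union are cut down to `T` and corrected at a common index `k`, so that both
parts have sum zero. This computes joins of points and lines. -/
theorem flat_union (x : Fin 5 → W) {T T' : Finset (Fin 5)} (h : (T ∩ T').Nonempty) :
    flat x (T ∪ T') = flat x T ⊔ flat x T' := by
  refine le_antisymm ?_ (sup_le (flat_mono x Finset.subset_union_left)
    (flat_mono x Finset.subset_union_right))
  rintro _ ⟨t, ht, ht', rfl⟩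
  obtain ⟨k, hk⟩ := h
  rw [Finset.mem_inter] at hk
  set c := ∑ i, (if i ∈ T then t i else 0) with hc
  let u : Fin 5 → ℂ := fun i => (if i ∈ T then t i else 0) - (if i = k then c else 0)
  have hu : ∑ i, u i = 0 := by simp [u, Finset.sum_sub_distrib, hc]
  have key : ∑ i, t i • x i = ∑ i, u i • x i + ∑ i, (t - u) i • x i := by
    rw [← Finset.sum_add_distrib]
    exact Finset.sum_congr rfl fun i _ => by rw [← add_smul]; simp
  rw [key]
  refine Submodule.add_mem_sup ⟨u, hu, fun i hi => ?_, rfl⟩ ⟨t - u, ?_, fun i hi => ?_, rfl⟩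
  · have : i ≠ k := fun h => hi (h ▸ hk.1)
    simp [u, hi, this]
  · simp [Finset.sum_sub_distrib, ht, hu]
  · have : i ≠ k := fun h => hi (h ▸ hk.2)
    by_cases hT : i ∈ T
    · simp [u, hT, this]
    · simp [u, hT, this, ht' i (by simp [hT, hi])]

theorem flat_pair (x : Fin 5 → W) {i j : Fin 5} (hij : i ≠ j) :
    flat x {i, j} = Submodule.span ℂ {x i - x j} := by
  refine le_antisymm ?_ ?_
  · rintro _ ⟨t, ht, ht', rfl⟩
    have h0 : ∀ k, k ∉ ({i, j} : Finset (Fin 5)) → t k • x k = 0 := fun k hk => by simp [ht' k hk]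
    rw [← Finset.sum_subset (Finset.subset_univ {i, j}) fun k _ hk => ht' k hk,
      Finset.sum_pair hij] at ht
    rw [← Finset.sum_subset (Finset.subset_univ {i, j}) fun k _ hk => h0 k hk,
      Finset.sum_pair hij, Submodule.mem_span_singleton]
    refine ⟨t i, ?_⟩
    rw [eq_neg_of_add_eq_zero_right ht, smul_sub, neg_smul, sub_eq_add_neg]
  · rw [Submodule.span_singleton_le_iff_mem]
    exact sub_mem_flat x (by simp) (by simp)

theorem map_flat (φ : W →ₗ[ℂ] W') (x : Fin 5 → W) (T : Finset (Fin 5)) :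
    Submodule.map φ (flat x T) = flat (fun i => φ (x i)) T := by
  ext v
  constructor
  · rintro ⟨_, ⟨t, ht, ht', rfl⟩, rfl⟩
    exact ⟨t, ht, ht', by simp⟩
  · rintro ⟨t, ht, ht', rfl⟩
    exact ⟨_, ⟨t, ht, ht', rfl⟩, by simp⟩

/-- Combinations with coefficient sum zero see only differences, so a pentad matters only up to
translation. -/
theorem flat_congr {x y : Fin 5 → W} (h : ∀ i, x i - x 4 = y i - y 4) (T : Finset (Fin 5)) :
    flat x T = flat y T := by
  ext v
  rw [mem_flat, mem_flat]
  refine exists_congr fun t => and_congr_right fun ht => and_congr_right fun _ => ?_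
  have key : ∀ z : Fin 5 → W, ∑ i, t i • z i = ∑ i, t i • (z i - z 4) := fun z => by
    simp [smul_sub, Finset.sum_sub_distrib, ← Finset.sum_smul, ht]
  rw [key x, key y]
  simp only [h]

theorem flat_comp (x : Fin 5 → W) (σ : Equiv.Perm (Fin 5)) (T : Finset (Fin 5)) :
    flat (x ∘ σ) T = flat x (T.map σ.toEmbedding) := by
  ext v
  constructor
  · rintro ⟨t, ht, ht', rfl⟩
    refine ⟨t ∘ σ.symm, ?_, fun i hi => ht' _ fun h => hi ?_, ?_⟩
    · rw [← ht]; exact Equiv.sum_comp σ.symm t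
    · exact Finset.mem_map.2 ⟨_, h, by simp⟩
    · rw [← Equiv.sum_comp σ]; simp
  · rintro ⟨t, ht, ht', rfl⟩
    refine ⟨t ∘ σ, ?_, fun i hi => ht' _ fun h => hi ?_, ?_⟩
    · rw [← ht]; exact Equiv.sum_comp σ t
    · simpa using h
    · exact Equiv.sum_comp σ fun i => t i • x i

/-- Five points in a space of dimension three, no four of which are in a plane; they are given by
vectors `x i` up to translation, and satisfy the affine relation with coefficients `s i`. -/
structure IsPentad (x : Fin 5 → W) (s : Fin 5 → ℂ) : Prop where
  ne : ∀ i, s i ≠ 0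
  sum : ∑ i, s i = 0
  rel : ∑ i, s i • x i = 0
  unique : ∀ t : Fin 5 → ℂ, ∑ i, t i = 0 → ∑ i, t i • x i = 0 → ∃ c : ℂ, ∀ i, t i = c * s i
  finrank : Module.finrank ℂ W = 3

namespace IsPentad

variable {x : Fin 5 → W} {s : Fin 5 → ℂ} {y : Fin 5 → W'} {r : Fin 5 → ℂ}

theorem comp (h : IsPentad x s) (σ : Equiv.Perm (Fin 5)) : IsPentad (x ∘ σ) (s ∘ σ) where
  ne i := h.ne _
  sum := by rw [← h.sum]; exact Equiv.sum_comp σ s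
  rel := by rw [← h.rel]; exact Equiv.sum_comp σ fun i => s i • x i
  unique t ht ht' := by
    obtain ⟨c, hc⟩ := h.unique (t ∘ σ.symm) (by rw [← ht]; exact Equiv.sum_comp σ.symm t)
      (by rw [← ht', ← Equiv.sum_comp σ]; simp)
    exact ⟨c, fun i => by simpa using hc (σ i)⟩
  finrank := h.finrank

/-- The two coefficient vectors differ by a multiple of `s`, which has no zero entry; agreement at
one index makes the multiple zero. -/
theorem eq_of_supported (h : IsPentad x s) {t u : Fin 5 → ℂ} (ht : ∑ i, t i = 0)
    (hu : ∑ i, u i = 0) (htu : ∑ i, t i • x i = ∑ i, u i • x i) {k : Fin 5} (hk : t k = u k) :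
    t = u := by
  obtain ⟨c, hc⟩ := h.unique (t - u) (by simp [Finset.sum_sub_distrib, ht, hu])
    (by simp [sub_smul, Finset.sum_sub_distrib, htu])
  have hc0 : c = 0 := by
    have := hc k
    simp only [Pi.sub_apply, hk, sub_self] at this
    exact (mul_eq_zero.1 this.symm).resolve_right (h.ne k)
  funext i
  have := hc i
  rw [hc0, zero_mul] at this
  exact sub_eq_zero.1 this

/-- At an index outside `T ∪ T'` both expressions of a common vector have coefficient zero, so they
coincide and are supported on the intersection. -/
theorem flat_inter (h : IsPentad x s) {T T' : Finset (Fin 5)} (hT : T ∪ T' ≠ Finset.univ) :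
    flat x (T ∩ T') = flat x T ⊓ flat x T' := by
  refine le_antisymm (le_inf (flat_mono x Finset.inter_subset_left)
    (flat_mono x Finset.inter_subset_right)) ?_
  rintro _ ⟨⟨t, ht, ht', rfl⟩, ⟨u, hu, hu', htu⟩⟩
  obtain ⟨k, hk⟩ : ∃ k, k ∉ T ∪ T' := by simpa [Finset.eq_univ_iff_forall] using hT
  simp only [Finset.mem_union, not_or] at hk
  obtain rfl := h.eq_of_supported hu ht htu (by rw [ht' k hk.1, hu' k hk.2])
  refine ⟨u, hu, fun i hi => ?_, rfl⟩
  by_cases hi' : i ∈ T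
  · exact hu' i fun h => hi (Finset.mem_inter.2 ⟨hi', h⟩)
  · exact ht' i hi'

theorem linearIndependent (h : IsPentad x s) :
    LinearIndependent ℂ (fun i : Fin 3 => x i.castSucc.castSucc - x 4) := by
  rw [Fintype.linearIndependent_iff]
  intro g hg
  have := h.eq_of_supported (t := ![g 0, g 1, g 2, 0, -(g 0 + g 1 + g 2)]) (u := 0) (k := 3)
    (by simp [Fin.sum_univ_five]) (by simp) (by
      rw [Fin.sum_univ_three] at hg
      simp only [Fin.sum_univ_five]
      simp only [Matrix.cons_val, Pi.zero_apply, zero_smul, add_zero]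
      rw [← hg]
      simp only [Fin.castSucc_zero, Fin.reduceCastSucc, Fin.isValue]
      module) (by simp)
  intro i
  fin_cases i
  · simpa using congrFun this 0
  · simpa using congrFun this 1
  · simpa using congrFun this 2

/-- The differences `x 0 - x 4`, `x 1 - x 4`, `x 2 - x 4` form a basis. -/
def basis (h : IsPentad x s) : Module.Basis (Fin 3) ℂ W :=
  basisOfLinearIndependentOfCardEqFinrank h.linearIndependent (by simp [h.finrank])

theorem basis_apply (h : IsPentad x s) (i : Fin 3) :
    h.basis i = x i.castSucc.castSucc - x 4 := by simp [basis]

theorem flat_eq_top (h : IsPentad x s) {T : Finset (Fin 5)} {k : Fin 5} (hT : ∀ i ≠ k, i ∈ T) :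
    flat x T = ⊤ := by
  have h1 : flat x Finset.univ = ⊤ := by
    rw [eq_top_iff, ← h.basis.span_eq, Submodule.span_le]
    rintro _ ⟨i, rfl⟩
    rw [h.basis_apply]
    exact sub_mem_flat x (by simp) (by simp)
  rw [eq_top_iff, ← h1]
  rintro _ ⟨t, ht, -, rfl⟩
  -- Subtracting this multiple of the relation clears the entry at `k` without changing the vector.
  refine ⟨fun i => t i - t k / s k * s i, ?_, fun i hi => ?_, ?_⟩
  · simp [Finset.sum_sub_distrib, ht, ← Finset.mul_sum, h.sum]
  · obtain rfl : i = k := by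
      by_contra hne
      exact hi (hT i hne)
    simp [div_mul_cancel₀ _ (h.ne i)]
  · simp [sub_smul, Finset.sum_sub_distrib, mul_smul, ← Finset.smul_sum, h.rel]

theorem sub_ne_zero (h : IsPentad x s) {i j : Fin 5} (hij : i ≠ j) : x i - x j ≠ 0 := by
  intro h0
  obtain ⟨k, hki, hkj⟩ : ∃ k, k ≠ i ∧ k ≠ j := by
    clear h0
    revert i j; decide
  have := h.eq_of_supported (t := Pi.single i 1 - Pi.single j 1) (u := 0) (k := k) (by simp)
    (by simp) (by simp [sub_smul, Finset.sum_sub_distrib, Pi.single_apply, ite_smul, h0])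
    (by simp [hki, hkj])
  simpa [hij] using congrFun this i

theorem finrank_flat_pair (h : IsPentad x s) {i j : Fin 5} (hij : i ≠ j) :
    Module.finrank ℂ (flat x {i, j}) = 1 := by
  rw [flat_pair x hij]
  exact finrank_span_singleton (h.sub_ne_zero hij)

/-- Incidence of the points and lines of the configuration of a pentad. -/
theorem flat_le_flat_compl_iff (h : IsPentad x s) {a b : Finset (Fin 5)} (ha : a.card = 2)
    (hb : b.card = 2) :
    flat x a ≤ flat x bᶜ ↔ Disjoint a b ∨ (a = b ∧ ∑ i ∈ b, s i = 0) := by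
  constructor
  · intro hab
    by_contra! hne
    obtain ⟨hd, hne⟩ := hne
    obtain ⟨i, hia, hib⟩ := Finset.not_disjoint_iff.1 hd
    obtain ⟨j, hj⟩ := Finset.card_eq_one.1 (by rw [Finset.card_erase_of_mem hia, ha] :
      (a.erase i).card = 1)
    obtain ⟨l, hl⟩ := Finset.card_eq_one.1 (by rw [Finset.card_erase_of_mem hib, hb] :
      (b.erase i).card = 1)
    have hij : i ≠ j := (Finset.ne_of_mem_erase (hj ▸ Finset.mem_singleton_self j)).symm
    have hil : i ≠ l := (Finset.ne_of_mem_erase (hl ▸ Finset.mem_singleton_self l)).symm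
    obtain rfl : a = {i, j} := by rw [← hj, Finset.insert_erase hia]
    obtain rfl : b = {i, l} := by rw [← hl, Finset.insert_erase hib]
    obtain ⟨t, ht, ht', htx⟩ := hab (sub_mem_flat x (i := i) (j := j) (by simp) (by simp))
    have hti : t i = 0 := ht' i (by simp)
    have htl : t l = 0 := ht' l (by simp)
    -- This affine relation has entry 1 at `i`, so `c ≠ 0`. Its entry at `l` is 0 if `l ≠ j`, which
    -- is impossible, and -1 if `l = j`, which makes the two coefficients cancel.
    obtain ⟨c, hc⟩ := h.unique (Pi.single i 1 - Pi.single j 1 - t)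
      (by simp [Finset.sum_sub_distrib, ht])
      (by simp [sub_smul, Finset.sum_sub_distrib, Pi.single_apply, ite_smul, htx])
    have hci := hc i
    have hcl := hc l
    simp only [Pi.sub_apply, Pi.single_eq_same, hti, htl, Pi.single_eq_of_ne hij,
      Pi.single_eq_of_ne hil.symm] at hci hcl
    have hc0 : c ≠ 0 := by
      rintro rfl
      simp at hci
    by_cases hlj : l = j
    · subst hlj
      refine hne rfl ?_
      rw [Finset.sum_pair hil]
      refine (mul_eq_zero.1 (?_ : c * _ = 0)).resolve_left hc0
      rw [mul_add, ← hci, ← hcl]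
      simp
    · rw [Pi.single_eq_of_ne hlj] at hcl
      simp only [sub_self] at hcl
      exact (mul_ne_zero hc0 (h.ne l)) hcl.symm
  · rintro (hd | ⟨rfl, hs⟩)
    · exact flat_mono x fun i hi => Finset.mem_compl.2 (Finset.disjoint_left.1 hd hi)
    · obtain ⟨i, j, hij, rfl⟩ := Finset.card_eq_two.1 ha
      rw [Finset.sum_pair hij] at hs
      rw [flat_pair x hij, Submodule.span_singleton_le_iff_mem]
      -- Since `s j = -s i`, one multiple of the relation clears the entries at both `i` and `j`.
      refine ⟨fun k => (Pi.single i 1 - Pi.single j 1 : Fin 5 → ℂ) k - (s i)⁻¹ * s k, ?_,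
        fun k hk => ?_, ?_⟩
      · simp [Finset.sum_sub_distrib, ← Finset.mul_sum, h.sum]
      · have hi := h.ne i
        simp only [Finset.mem_compl, Finset.mem_insert, Finset.mem_singleton, not_not] at hk
        obtain rfl | rfl := hk
        · simp [hij, hi]
        · simp only [Pi.sub_apply, Pi.single_eq_same, Pi.single_eq_of_ne hij.symm]
          rw [eq_neg_of_add_eq_zero_right hs]
          field_simp
          ring
      · simp [sub_smul, Finset.sum_sub_distrib, Pi.single_apply, ite_smul, mul_smul,
          ← Finset.smul_sum, h.rel]

/-- Different pairs share at most one index, so their directions would meet in `flat` of at most a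
singleton, which is zero. -/
theorem flat_injOn (h : IsPentad x s) {a b : Finset (Fin 5)} (ha : a.card = 2) (hb : b.card = 2)
    (hab : flat x a = flat x b) : a = b := by
  have hu : a ∪ b ≠ Finset.univ := by
    intro hu
    have := Finset.card_union_le a b
    rw [hu, ha, hb] at this
    simp at this
  obtain ⟨i, j, hij, rfl⟩ := Finset.card_eq_two.1 ha
  have hi : flat x ({i, j} ∩ b) = flat x {i, j} := by
    rw [h.flat_inter hu, ← hab, inf_idem]
  have hs : {i, j} ⊆ b := by
    by_contra hs
    have hc : (({i, j} : Finset (Fin 5)) ∩ b).card < 2 := by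
      rw [← ha]
      refine Finset.card_lt_card ⟨Finset.inter_subset_left, fun hle => hs ?_⟩
      exact hle.trans Finset.inter_subset_right
    have hz : flat x ({i, j} ∩ b) = ⊥ := by
      obtain ⟨k, hk⟩ := Finset.card_le_one_iff_subset_singleton.1 (Nat.lt_succ_iff.1 hc)
      rw [eq_bot_iff]
      refine (flat_mono x hk).trans ?_
      rintro _ ⟨t, ht, ht', rfl⟩
      rw [Finset.sum_eq_single k (fun l _ hl => ht' l (by simpa using hl)) (by simp)] at ht
      refine Finset.sum_eq_zero fun l _ => ?_
      by_cases hl : l = k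
      · rw [hl, ht, zero_smul]
      · rw [ht' l (by simpa using hl), zero_smul]
    have := h.finrank_flat_pair hij
    rw [← hi, hz] at this
    simp at this
  exact Finset.eq_of_subset_of_card_le hs (by rw [ha, hb])

theorem rel_sub (h : IsPentad x s) (k : Fin 5) : ∑ i, s i • (x i - x k) = 0 := by
  simp [smul_sub, Finset.sum_sub_distrib, h.rel, ← Finset.sum_smul, h.sum]

/-- The linear isomorphism that maps one pentad to another one with the same coefficients. -/
def equiv (h : IsPentad x s) (h' : IsPentad y s) : W ≃ₗ[ℂ] W' :=
  h.basis.equiv h'.basis (Equiv.refl _)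

theorem equiv_sub (h : IsPentad x s) (h' : IsPentad y s) (i : Fin 5) :
    h.equiv h' (x i - x 4) = y i - y 4 := by
  have key : ∀ i : Fin 3, h.equiv h' (x i.castSucc.castSucc - x 4) =
      y i.castSucc.castSucc - y 4 := fun i => by
    rw [← h.basis_apply, ← h'.basis_apply, equiv, Module.Basis.equiv_apply, Equiv.refl_apply]
  have h0 : h.equiv h' (x 0 - x 4) = y 0 - y 4 := key 0
  have h1 : h.equiv h' (x 1 - x 4) = y 1 - y 4 := key 1
  have h2 : h.equiv h' (x 2 - x 4) = y 2 - y 4 := key 2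
  have h4 : h.equiv h' (x 4 - x 4) = y 4 - y 4 := by simp
  -- The remaining difference is determined by the others through the relation; here the equality of
  -- the coefficients is needed.
  have h3 : h.equiv h' (x 3 - x 4) = y 3 - y 4 := by
    have e := congrArg (h.equiv h') (h.rel_sub 4)
    have e' := h'.rel_sub 4
    rw [Fin.sum_univ_five] at e e'
    simp only [map_add, map_smul, h0, h1, h2, h4, map_zero] at e
    rw [← e'] at e
    exact smul_right_injective _ (h.ne 3) (by simpa using e)
  fin_cases i
  exacts [h0, h1, h2, h3, h4]

theorem map_equiv_flat (h : IsPentad x s) (h' : IsPentad y s) (T : Finset (Fin 5)) :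
    Submodule.map (h.equiv h' : W →ₗ[ℂ] W') (flat x T) = flat y T := by
  rw [map_flat]
  refine flat_congr (fun i => ?_) T
  rw [← h.equiv_sub h' i, map_sub]
  rfl

/-- A linear isomorphism that maps the points `flat x {i, j}` of a pentad to those of another one
maps the relation of the first one to that of the second one. -/
theorem eq_smul_of_map_flat (h : IsPentad x s) (h' : IsPentad y r) (φ : W ≃ₗ[ℂ] W')
    (hφ : ∀ a : Finset (Fin 5), a.card = 2 →
      Submodule.map (φ : W →ₗ[ℂ] W') (flat x a) = flat y a) :
    ∃ c : ℂ, c ≠ 0 ∧ ∀ i, r i = c * s i := by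
  have hex : ∀ i j : Fin 5, i ≠ j → ∃ c : ℂ, φ (x i - x j) = c • (y i - y j) := by
    intro i j hij
    have := hφ {i, j} (Finset.card_pair hij)
    rw [flat_pair x hij, flat_pair y hij, Submodule.map_span, Set.image_singleton] at this
    have h1 : φ (x i - x j) ∈ Submodule.span ℂ {y i - y j} := by
      rw [← this]
      exact Submodule.mem_span_singleton_self _
    obtain ⟨c, hc⟩ := Submodule.mem_span_singleton.1 h1
    exact ⟨c, hc.symm⟩
  choose! c hc using hex
  -- Expanding `φ (x i - x j)` through `x 4` gives two expressions that both avoid a further index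
  -- `k`; comparing their entries at 4 shows that the scalars agree.
  have hcc : ∀ i j : Fin 5, i ≠ 4 → j ≠ 4 → i ≠ j → c i 4 = c j 4 := by
    intro i j hi hj hij
    have e : c i 4 • (y i - y 4) - c j 4 • (y j - y 4) = c i j • (y i - y j) := by
      rw [← hc i 4 hi, ← hc j 4 hj, ← hc i j hij, ← map_sub]
      congr 1
      abel
    obtain ⟨k, hki, hkj, hk4⟩ : ∃ k : Fin 5, k ≠ i ∧ k ≠ j ∧ k ≠ 4 := by
      clear e
      revert i j
      decide
    have := h'.eq_of_supported (k := k)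
      (t := c i 4 • (Pi.single i 1 - Pi.single 4 1) - c j 4 • (Pi.single j 1 - Pi.single 4 1))
      (u := c i j • (Pi.single i 1 - Pi.single j 1))
      (by simp [Finset.sum_sub_distrib, ← Finset.mul_sum])
      (by simp [Finset.sum_sub_distrib, ← Finset.mul_sum])
      (by
        simpa [sub_smul, mul_smul, Finset.sum_sub_distrib, ← Finset.smul_sum, Pi.single_apply,
          ite_smul] using e)
      (by simp [hki, hkj, hk4])
    have := congrFun this 4
    simp [hi.symm, hj.symm] at this
    linear_combination -this
  have hall : ∀ i, φ (x i - x 4) = c 0 4 • (y i - y 4) := by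
    intro i
    by_cases hi : i = 4
    · simp [hi]
    · rw [hc i 4 hi]
      by_cases h0 : i = 0
      · rw [h0]
      · rw [hcc i 0 hi (by decide) h0]
  have hc0 : c 0 4 ≠ 0 := by
    intro h0
    have := hall 0
    rw [h0, zero_smul, map_eq_zero_iff φ φ.injective] at this
    exact h.sub_ne_zero (by decide) this
  have hrel := congrArg φ (h.rel_sub 4)
  simp only [map_sum, map_smul, hall, map_zero] at hrel
  -- Up to one common scalar, `φ` takes the differences of `x` to those of `y`, so `s` is also a
  -- relation of `y`.
  have hrel' : ∑ i, s i • y i = 0 := by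
    have : c 0 4 • ∑ i, s i • (y i - y 4) = 0 := by
      rw [← hrel, Finset.smul_sum]
      exact Finset.sum_congr rfl fun i _ => smul_comm _ _ _
    have := (smul_eq_zero.1 this).resolve_left hc0
    simpa [smul_sub, Finset.sum_sub_distrib, ← Finset.sum_smul, h.sum] using this
  obtain ⟨d, hd⟩ := h'.unique s h.sum hrel'
  have hd0 : d ≠ 0 := by
    rintro rfl
    exact h.ne 0 (by simpa using hd 0)
  exact ⟨d⁻¹, inv_ne_zero hd0, fun i => by rw [hd, inv_mul_cancel_left₀ hd0]⟩

end IsPentad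

end Pentad

/-! ### Combinatorics of the ten points and ten lines -/

/-- The two-element subsets of `Fin 5`, which index the points and the lines of a Desargues
configuration. -/
abbrev Duad : Type := {a : Finset (Fin 5) // a.card = 2}

namespace Duad

/-- This detects disjointness of two points by incidence: when `a` and `b` meet, the two indices
outside `a ∪ b` give a common line; when they are disjoint, only one index is left. -/
theorem disjoint_iff (a b : Duad) (hab : a ≠ b) :
    Disjoint a.1 b.1 ↔ ¬ ∃ c : Duad, Disjoint a.1 c.1 ∧ Disjoint b.1 c.1 := by
  revert a b
  decide

/-- Two different duads that are not disjoint. -/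
abbrev Meet (a b : Duad) : Prop := a ≠ b ∧ ¬ Disjoint a.1 b.1

set_option synthInstance.maxHeartbeats 400000 in
set_option synthInstance.maxSize 1000 in
set_option maxRecDepth 10000 in
-- Pairwise meeting pairs form a star or a triangle, and a triangle has only three edges.
theorem inter_nonempty_of_meet : ∀ a b : Duad, Meet a b → ∀ c : Duad, Meet a c ∧ Meet b c →
    ∀ d : Duad, Meet a d ∧ Meet b d ∧ Meet c d → (a.1 ∩ b.1 ∩ (c.1 ∩ d.1)).Nonempty := by
  decide

theorem card_filter_disjoint (b : Duad) :
    (Finset.univ.filter fun a : Duad => Disjoint a.1 b.1).card = 3 := by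
  revert b
  decide

/-- The duad `{i, j}`. -/
def mk (i j : Fin 5) (h : i ≠ j) : Duad := ⟨{i, j}, Finset.card_pair h⟩

theorem eq_mk (a : Duad) : ∃ i j, ∃ h : i ≠ j, a = mk i j h := by
  obtain ⟨i, j, h, e⟩ := Finset.card_eq_two.1 a.2
  exact ⟨i, j, h, Subtype.ext e⟩

theorem mk_comm (i j : Fin 5) (h : i ≠ j) : mk i j h = mk j i h.symm :=
  Subtype.ext (Finset.pair_comm i j)

theorem meet_mk {i j k : Fin 5} (hj : i ≠ j) (hk : i ≠ k) (h : j ≠ k) :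
    Meet (mk i j hj) (mk i k hk) := by
  refine ⟨fun e => ?_, Finset.not_disjoint_iff.2 ⟨i, by simp [mk], by simp [mk]⟩⟩
  have : j ∈ (mk i k hk).1 := e ▸ (by simp [mk])
  simp [mk, hj.symm, h] at this

/-- The bijections of the points and of the lines of Desargues' configuration that preserve
incidence are induced by a permutation of five letters. -/
theorem exists_perm_of_disjoint_iff (f g : Equiv.Perm Duad)
    (hfg : ∀ a b : Duad, Disjoint a.1 b.1 ↔ Disjoint (f a).1 (g b).1) :
    ∃ σ : Equiv.Perm (Fin 5), ∀ a : Duad, (f a).1 = a.1.map σ.toEmbedding := by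
  have hf : ∀ a b : Duad, a ≠ b → (Disjoint a.1 b.1 ↔ Disjoint (f a).1 (f b).1) := by
    intro a b hab
    rw [disjoint_iff a b hab, disjoint_iff _ _ (f.injective.ne hab), not_iff_not]
    constructor
    · rintro ⟨c, h1, h2⟩
      exact ⟨g c, (hfg _ _).1 h1, (hfg _ _).1 h2⟩
    · rintro ⟨c, h1, h2⟩
      exact ⟨g.symm c, (hfg _ _).2 (by simpa using h1), (hfg _ _).2 (by simpa using h2)⟩
  have hmeet : ∀ a b : Duad, Meet a b → Meet (f a) (f b) := fun a b h =>
    ⟨f.injective.ne h.1, fun h' => h.2 ((hf a b h.1).2 h')⟩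
  -- The star of four duads through `i` is mapped to a star; its centre will be `σ i`.
  have hex : ∀ i : Fin 5, ∃ v, ∀ j, ∀ h : i ≠ j, v ∈ (f (mk i j h)).1 := by
    intro i
    obtain ⟨j, k, l, m, hj, hk, hl, hm, hjk, hjl, hjm, hkl, hkm, hlm, hall⟩ :
        ∃ j k l m : Fin 5, i ≠ j ∧ i ≠ k ∧ i ≠ l ∧ i ≠ m ∧ j ≠ k ∧ j ≠ l ∧ j ≠ m ∧ k ≠ l ∧ k ≠ m ∧
          l ≠ m ∧ ∀ n, i ≠ n → n = j ∨ n = k ∨ n = l ∨ n = m := by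
      revert i
      decide
    obtain ⟨v, hv⟩ := inter_nonempty_of_meet
      (f (mk i j hj)) (f (mk i k hk)) (hmeet _ _ (meet_mk hj hk hjk))
      (f (mk i l hl)) ⟨hmeet _ _ (meet_mk hj hl hjl), hmeet _ _ (meet_mk hk hl hkl)⟩
      (f (mk i m hm)) ⟨hmeet _ _ (meet_mk hj hm hjm), hmeet _ _ (meet_mk hk hm hkm),
        hmeet _ _ (meet_mk hl hm hlm)⟩
    simp only [Finset.mem_inter] at hv
    obtain ⟨⟨h1, h2⟩, h3, h4⟩ := hv
    refine ⟨v, fun n hn => ?_⟩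
    obtain rfl | rfl | rfl | rfl := hall n hn <;> assumption
  choose σ hσ using hex
  have hinj : Function.Injective σ := by
    intro i j hij
    by_contra hne
    obtain ⟨k, l, hik, hjl, hil, hjk, hkl⟩ : ∃ k l : Fin 5, i ≠ k ∧ j ≠ l ∧ i ≠ l ∧ j ≠ k ∧
        k ≠ l := by
      clear hij
      revert i j
      decide
    have h1 := hσ i k hik
    have h2 := hσ j l hjl
    rw [← hij] at h2
    have hd : Disjoint (mk i k hik).1 (mk j l hjl).1 := by
      rw [Finset.disjoint_left]
      intro m hm hm'
      simp only [mk, Finset.mem_insert, Finset.mem_singleton] at hm hm'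
      obtain rfl | rfl := hm <;> obtain h | h := hm' <;> simp_all
    have hne' : mk i k hik ≠ mk j l hjl := by
      intro e
      rw [e, disjoint_self, Finset.bot_eq_empty] at hd
      have := (mk j l hjl).2
      rw [hd] at this
      simp at this
    exact Finset.disjoint_left.1 ((hf _ _ hne').1 hd) h1 h2
  refine ⟨Equiv.ofBijective σ (Finite.injective_iff_bijective.1 hinj), fun a => ?_⟩
  obtain ⟨i, j, h, rfl⟩ := a.eq_mk
  symm
  refine Finset.eq_of_subset_of_card_le (fun v hv => ?_) ?_
  · obtain ⟨n, hn, rfl⟩ := Finset.mem_map.1 hv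
    simp only [mk, Finset.mem_insert, Finset.mem_singleton] at hn
    obtain rfl | rfl := hn
    · exact hσ _ _ h
    · rw [mk_comm]
      exact hσ _ _ h.symm
  · rw [Finset.card_map, (f _).2, (mk i j h).2]

/-- The relation `Disjoint a b ∨ (a = b ∧ p b)` is the incidence relation of a Desargues
configuration in which the lines `b` with `p b` contain a fourth point. -/
theorem card_filter_incident (p : Duad → Prop) [DecidablePred p] (b : Duad) :
    (Finset.univ.filter fun a : Duad => Disjoint a.1 b.1 ∨ (a = b ∧ p b)).card =
      if p b then 4 else 3 := by
  by_cases hb : p b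
  · have : (Finset.univ.filter fun a : Duad => Disjoint a.1 b.1 ∨ (a = b ∧ p b)) =
        insert b (Finset.univ.filter fun a : Duad => Disjoint a.1 b.1) := by
      ext a
      simp [hb, or_comm]
    rw [this, Finset.card_insert_of_notMem, card_filter_disjoint, if_pos hb]
    have := b.2
    simp only [Finset.mem_filter, Finset.mem_univ, true_and, disjoint_self, Finset.bot_eq_empty]
    intro h
    rw [h] at this
    simp at this
  · simp [hb, card_filter_disjoint]

/-- The number of points on a line, 4 or 3, is invariant and detects whether the line is special. -/
theorem special_iff_of_incident_iff {p p' : Duad → Prop} (f g : Equiv.Perm Duad)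
    (hfg : ∀ a b : Duad, (Disjoint a.1 b.1 ∨ (a = b ∧ p b)) ↔
      (Disjoint (f a).1 (g b).1 ∨ (f a = g b ∧ p' (g b)))) (b : Duad) : p b ↔ p' (g b) := by
  classical
  have h1 := card_filter_incident p b
  have h2 := card_filter_incident p' (g b)
  have h3 : (Finset.univ.filter fun a : Duad => Disjoint a.1 b.1 ∨ (a = b ∧ p b)).card =
      (Finset.univ.filter fun a : Duad => Disjoint a.1 (g b).1 ∨ (a = g b ∧ p' (g b))).card := by
    refine Finset.card_equiv f fun a => ?_
    simp [hfg]
  rw [h1, h2] at h3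
  by_cases hb : p b <;> by_cases hb' : p' (g b) <;> simp [hb, hb'] at h3 ⊢

/-- If no two disjoint duads are special, then the isomorphisms of special Desargues configurations
are induced by permutations as well. -/
theorem exists_perm_of_incident_iff {p p' : Duad → Prop} (f g : Equiv.Perm Duad)
    (hp : ∀ a b : Duad, p a → p b → ¬ Disjoint a.1 b.1)
    (hp' : ∀ a b : Duad, p' a → p' b → ¬ Disjoint a.1 b.1)
    (hfg : ∀ a b : Duad, (Disjoint a.1 b.1 ∨ (a = b ∧ p b)) ↔
      (Disjoint (f a).1 (g b).1 ∨ (f a = g b ∧ p' (g b)))) :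
    ∃ σ : Equiv.Perm (Fin 5), ∀ a : Duad, (f a).1 = a.1.map σ.toEmbedding := by
  have hg : ∀ b, p b ↔ p' (g b) := special_iff_of_incident_iff f g hfg
  have hf : ∀ a, p a ↔ p' (f a) := by
    -- The same count in the dual configuration: the lines through a point.
    refine special_iff_of_incident_iff g f fun a b => ?_
    rw [disjoint_comm, disjoint_comm (a := (g a).1)]
    have := hfg b a
    rw [← hg] at this
    constructor
    · rintro (h | ⟨rfl, h⟩)
      · obtain h' | h' := this.1 (Or.inl h)
        · exact Or.inl h'
        · exact Or.inr ⟨h'.1.symm, h'.1 ▸ (hg a).1 h'.2⟩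
      · obtain h' | h' := this.1 (Or.inr ⟨rfl, h⟩)
        · exact Or.inl h'
        · exact Or.inr ⟨h'.1.symm, h'.1 ▸ (hg a).1 h'.2⟩
    · rintro (h | ⟨h, h''⟩)
      · obtain h' | h' := this.2 (Or.inl h)
        · exact Or.inl h'
        · exact Or.inr ⟨h'.1.symm, h'.1 ▸ h'.2⟩
      · obtain h' | h' := this.2 (Or.inr ⟨h.symm, (hg a).2 (h ▸ h'')⟩)
        · exact Or.inl h'
        · exact Or.inr ⟨h'.1.symm, h'.1 ▸ h'.2⟩
  -- If an ordinary incidence became an extra one, or conversely, two disjoint duads would both be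
  -- special.
  refine exists_perm_of_disjoint_iff f g fun a b => ⟨fun h => ?_, fun h => ?_⟩
  · obtain h' | ⟨h1, h2⟩ := (hfg a b).1 (Or.inl h)
    · exact h'
    · exact absurd h (hp a b ((hf a).2 (h1 ▸ h2)) ((hg b).2 h2))
  · obtain h' | ⟨h1, h2⟩ := (hfg a b).2 (Or.inl h)
    · exact h'
    · exact absurd h (hp' _ _ ((hf a).1 (h1 ▸ h2)) ((hg b).1 h2))

end Duad

/-! ### Desargues configurations and pentads -/

section PentadConfig

variable {W W' : Type} [AddCommGroup W] [Module ℂ W] [AddCommGroup W'] [Module ℂ W']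

/-- The configuration of ten points and ten lines of a pentad. -/
def pentadConfig (x : Fin 5 → W) : Configuration W where
  points := {p | ∃ a : Finset (Fin 5), a.card = 2 ∧ p = flat x a}
  lines := {l | ∃ T : Finset (Fin 5), T.card = 3 ∧ l = flat x T}

/-- The first three of five indices. -/
abbrev emb (i : Fin 3) : Fin 5 := i.castSucc.castSucc

namespace IsPentad

variable {x : Fin 5 → W} {s : Fin 5 → ℂ} {y : Fin 5 → W'} {r : Fin 5 → ℂ}

theorem smul (h : IsPentad x s) {c : ℂ} (hc : c ≠ 0) : IsPentad x (fun i => c * s i) where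
  ne i := mul_ne_zero hc (h.ne i)
  sum := by rw [← Finset.mul_sum, h.sum, mul_zero]
  rel := by simp [mul_smul, ← Finset.smul_sum, h.rel]
  unique t ht ht' := by
    obtain ⟨d, hd⟩ := h.unique t ht ht'
    exact ⟨d * c⁻¹, fun i => by rw [hd]; field_simp⟩
  finrank := h.finrank

theorem mem_lines_iff {l : Submodule ℂ W} :
    l ∈ (pentadConfig x).lines ↔ ∃ b : Finset (Fin 5), b.card = 2 ∧ l = flat x bᶜ := by
  constructor
  · rintro ⟨T, hT, rfl⟩
    exact ⟨Tᶜ, by rw [Finset.card_compl, hT]; rfl, by rw [compl_compl]⟩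
  · rintro ⟨b, hb, rfl⟩
    exact ⟨bᶜ, by rw [Finset.card_compl, hb]; rfl, rfl⟩

/-- The labelling takes `{3, 4}` as centre and `{i, 3}`, `{i, 4}` as vertices. Corresponding sides
are then `{i, j, 3}` and `{i, j, 4}`, which together omit an index. -/
theorem sideMeet_flat (h : IsPentad x s) {i j : Fin 3} (hij : i ≠ j) :
    Configuration.sideMeet (fun i => flat x {emb i, 3}) (fun i => flat x {emb i, 4}) i j =
      flat x {emb i, emb j} := by
  have hA : ({emb i, 3} ∩ {emb j, 3} : Finset (Fin 5)).Nonempty := ⟨3, by simp⟩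
  have hB : ({emb i, 4} ∩ {emb j, 4} : Finset (Fin 5)).Nonempty := ⟨4, by simp⟩
  rw [Configuration.sideMeet, ← flat_union x hA, ← flat_union x hB, ← h.flat_inter]
  · congr 1
    revert i j
    decide
  · revert i j
    decide

theorem points_eq (h : IsPentad x s) :
    (pentadConfig x).points = {flat x {3, 4}} ∪ Set.range (fun i => flat x {emb i, 3}) ∪
      Set.range (fun i => flat x {emb i, 4}) ∪ {p | ∃ i j, i ≠ j ∧ p =
        Configuration.sideMeet (fun i => flat x {emb i, 3}) (fun i => flat x {emb i, 4}) i j} := by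
  ext p
  constructor
  · rintro ⟨a, ha, rfl⟩
    obtain rfl | ⟨i, rfl⟩ | ⟨i, rfl⟩ | ⟨i, j, hij, rfl⟩ : a = {3, 4} ∨
        (∃ i : Fin 3, a = {emb i, 3}) ∨ (∃ i : Fin 3, a = {emb i, 4}) ∨
        ∃ i j : Fin 3, i ≠ j ∧ a = {emb i, emb j} := by
      revert a
      decide
    · exact Or.inl (Or.inl (Or.inl rfl))
    · exact Or.inl (Or.inl (Or.inr ⟨i, rfl⟩))
    · exact Or.inl (Or.inr ⟨i, rfl⟩)
    · exact Or.inr ⟨i, j, hij, (h.sideMeet_flat hij).symm⟩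
  · rintro (((rfl | ⟨i, rfl⟩) | ⟨i, rfl⟩) | ⟨i, j, hij, rfl⟩)
    · exact ⟨_, by decide, rfl⟩
    · exact ⟨{emb i, 3}, by revert i; decide, rfl⟩
    · exact ⟨{emb i, 4}, by revert i; decide, rfl⟩
    · exact ⟨{emb i, emb j}, by revert i j; decide, h.sideMeet_flat hij⟩

theorem lines_eq (h : IsPentad x s) :
    (pentadConfig x).lines =
      {l | ∃ i j : Fin 3, i ≠ j ∧ l = flat x {emb i, 3} ⊔ flat x {emb j, 3}} ∪
      {l | ∃ i j : Fin 3, i ≠ j ∧ l = flat x {emb i, 4} ⊔ flat x {emb j, 4}} ∪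
      {l | ∃ i : Fin 3, l = flat x {emb i, 3} ⊔ flat x {emb i, 4}} ∪
      {Configuration.sideMeet (fun i => flat x {emb i, 3}) (fun i => flat x {emb i, 4}) 0 1 ⊔
        Configuration.sideMeet (fun i => flat x {emb i, 3}) (fun i => flat x {emb i, 4}) 0 2 ⊔
        Configuration.sideMeet (fun i => flat x {emb i, 3}) (fun i => flat x {emb i, 4}) 1 2} := by
  have hA : ∀ i j : Fin 3, flat x {emb i, 3} ⊔ flat x {emb j, 3} = flat x {emb i, emb j, 3} := by
    intro i j
    rw [← flat_union x (T := {emb i, 3}) (T' := {emb j, 3}) ⟨3, by simp⟩]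
    congr 1
    revert i j
    decide
  have hB : ∀ i j : Fin 3, flat x {emb i, 4} ⊔ flat x {emb j, 4} = flat x {emb i, emb j, 4} := by
    intro i j
    rw [← flat_union x (T := {emb i, 4}) (T' := {emb j, 4}) ⟨4, by simp⟩]
    congr 1
    revert i j
    decide
  have hO : ∀ i : Fin 3, flat x {emb i, 3} ⊔ flat x {emb i, 4} = flat x {emb i, 3, 4} := by
    intro i
    rw [← flat_union x (T := {emb i, 3}) (T' := {emb i, 4}) ⟨emb i, by simp⟩]
    congr 1
    revert i
    decide
  have hC : flat x {emb 0, emb 1} ⊔ flat x {emb 0, emb 2} ⊔ flat x {emb 1, emb 2} =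
      flat x {0, 1, 2} := by
    rw [← flat_union x (by decide), ← flat_union x (by decide)]
    congr 1
  rw [h.sideMeet_flat (by decide), h.sideMeet_flat (by decide), h.sideMeet_flat (by decide), hC]
  simp only [hA, hB, hO]
  ext p
  constructor
  · rintro ⟨T, hT, rfl⟩
    obtain ⟨i, j, hij, rfl⟩ | ⟨i, j, hij, rfl⟩ | ⟨i, rfl⟩ | rfl :
        (∃ i j : Fin 3, i ≠ j ∧ T = {emb i, emb j, 3}) ∨
        (∃ i j : Fin 3, i ≠ j ∧ T = {emb i, emb j, 4}) ∨
        (∃ i : Fin 3, T = {emb i, 3, 4}) ∨ T = {0, 1, 2} := by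
      revert T
      decide
    · exact Or.inl (Or.inl (Or.inl ⟨i, j, hij, rfl⟩))
    · exact Or.inl (Or.inl (Or.inr ⟨i, j, hij, rfl⟩))
    · exact Or.inl (Or.inr ⟨i, rfl⟩)
    · exact Or.inr rfl
  · rintro (((⟨i, j, hij, rfl⟩ | ⟨i, j, hij, rfl⟩) | ⟨i, rfl⟩) | rfl)
    · exact ⟨{emb i, emb j, 3}, by revert i j; decide, rfl⟩
    · exact ⟨{emb i, emb j, 4}, by revert i j; decide, rfl⟩
    · exact ⟨{emb i, 3, 4}, by revert i; decide, rfl⟩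
    · exact ⟨{0, 1, 2}, by decide, rfl⟩

theorem isDesargues (h : IsPentad x s) : (pentadConfig x).IsDesargues := by
  refine ⟨h.finrank, flat x {3, 4}, fun i => flat x {emb i, 3}, fun i => flat x {emb i, 4},
    h.finrank_flat_pair (by decide), fun i => h.finrank_flat_pair (by revert i; decide),
    fun i => h.finrank_flat_pair (by revert i; decide), ?_, ?_, fun i => ?_, fun i => ?_,
    fun i j hij hle => ?_, fun i j hij hle => ?_, h.points_eq, h.lines_eq⟩
  · rw [← flat_union x (by decide), ← flat_union x (by decide)]
    exact h.flat_eq_top (k := 4) (by decide)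
  · rw [← flat_union x (by decide), ← flat_union x (by decide)]
    exact h.flat_eq_top (k := 3) (by decide)
  · intro e
    have h3 : ({emb i, 3} : Finset (Fin 5)).card = 2 := by clear e; revert i; decide
    have h4 : ({emb i, 4} : Finset (Fin 5)).card = 2 := by clear e; revert i; decide
    have := h.flat_injOn h3 h4 e
    clear e h3 h4
    revert i
    decide
  · rw [← flat_union x (T := {emb i, 3}) (T' := {emb i, 4}) ⟨emb i, by simp⟩]
    exact flat_mono x (by revert i; decide)
  · rw [← flat_union x (T := {emb i, 3}) (T' := {emb j, 3}) ⟨3, by simp⟩] at hle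
    obtain ⟨k, hk⟩ : ∃ k : Fin 3, ({emb i, 3} ∪ {emb j, 3} : Finset (Fin 5)) = {emb k, 4}ᶜ := by
      clear hle
      revert i j
      decide
    have hk2 : ({emb k, 4} : Finset (Fin 5)).card = 2 := by clear hk hle; revert k; decide
    rw [hk, h.flat_le_flat_compl_iff (by decide) hk2] at hle
    obtain hd | ⟨e, -⟩ := hle
    · revert hd
      simp
    · clear hk hk2
      revert k
      decide
  · rw [← flat_union x (T := {emb i, 4}) (T' := {emb j, 4}) ⟨4, by simp⟩] at hle
    obtain ⟨k, hk⟩ : ∃ k : Fin 3, ({emb i, 4} ∪ {emb j, 4} : Finset (Fin 5)) = {emb k, 3}ᶜ := by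
      clear hle
      revert i j
      decide
    have hk2 : ({emb k, 3} : Finset (Fin 5)).card = 2 := by clear hk hle; revert k; decide
    rw [hk, h.flat_le_flat_compl_iff (by decide) hk2] at hle
    obtain hd | ⟨e, -⟩ := hle
    · revert hd
      simp
    · clear hk hk2
      revert k
      decide

/-- The line of `b` contains the three points indexed by pairs outside `b`; the only possible fourth
is the point of `b` itself. -/
theorem isSpecialDesargues_iff (h : IsPentad x s) :
    (pentadConfig x).IsSpecialDesargues ↔
      ∃ b : Finset (Fin 5), b.card = 2 ∧ ∑ i ∈ b, s i = 0 := by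
  classical
  have hcard : ∀ b : Finset (Fin 5), b.card = 2 → (Finset.powersetCard 2 bᶜ).card = 3 :=
    fun b hb => by rw [Finset.card_powersetCard, Finset.card_compl, hb]; rfl
  constructor
  · rintro ⟨-, l, hl, S, hS, hSl⟩
    obtain ⟨b, hb, rfl⟩ := mem_lines_iff.1 hl
    refine ⟨b, hb, ?_⟩
    by_contra hne
    have hsub : S ⊆ (Finset.powersetCard 2 bᶜ).image (flat x) := by
      intro p hp
      obtain ⟨⟨a, ha, rfl⟩, hle⟩ := hSl p hp
      obtain hd | ⟨-, h0⟩ := (h.flat_le_flat_compl_iff ha hb).1 hle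
      · exact Finset.mem_image_of_mem _ (Finset.mem_powersetCard.2
          ⟨fun i hi => Finset.mem_compl.2 (Finset.disjoint_left.1 hd hi), ha⟩)
      · exact absurd h0 hne
    have := (Finset.card_le_card hsub).trans Finset.card_image_le
    rw [hS, hcard b hb] at this
    omega
  · rintro ⟨b, hb, h0⟩
    have hmem : ∀ a ∈ insert b (Finset.powersetCard 2 bᶜ), a.card = 2 ∧ (Disjoint a b ∨ a = b) := by
      intro a ha
      obtain rfl | ha := Finset.mem_insert.1 ha
      · exact ⟨hb, Or.inr rfl⟩
      · obtain ⟨h1, h2⟩ := Finset.mem_powersetCard.1 ha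
        exact ⟨h2, Or.inl (Finset.disjoint_left.2 fun i hi => Finset.mem_compl.1 (h1 hi))⟩
    refine ⟨h.isDesargues, flat x bᶜ, mem_lines_iff.2 ⟨b, hb, rfl⟩,
      (insert b (Finset.powersetCard 2 bᶜ)).image (flat x), ?_, fun p hp => ?_⟩
    · rw [Finset.card_image_of_injOn fun a ha a' ha' e =>
        h.flat_injOn (hmem a ha).1 (hmem a' ha').1 e, Finset.card_insert_of_notMem, hcard b hb]
      intro hmem'
      obtain ⟨i, hi⟩ := Finset.card_pos.1 (by rw [hb]; norm_num : 0 < b.card)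
      exact Finset.mem_compl.1 ((Finset.mem_powersetCard.1 hmem').1 hi) hi
    · obtain ⟨a, ha, rfl⟩ := Finset.mem_image.1 hp
      obtain ⟨h1, h2⟩ := hmem a ha
      exact ⟨⟨a, h1, rfl⟩, (h.flat_le_flat_compl_iff h1 hb).2 (h2.imp_right fun e => ⟨e, h0⟩)⟩

/-- Two disjoint cancelling pairs would force the fifth coefficient to vanish. -/
theorem not_disjoint_of_sum_eq_zero (h : IsPentad x s) {a b : Finset (Fin 5)} (ha : a.card = 2)
    (hb : b.card = 2) (ha0 : ∑ i ∈ a, s i = 0) (hb0 : ∑ i ∈ b, s i = 0) : ¬ Disjoint a b := by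
  intro hd
  have hc : (a ∪ b)ᶜ.card = 1 := by
    rw [Finset.card_compl, Finset.card_union_of_disjoint hd, ha, hb]
    rfl
  obtain ⟨k, hk⟩ := Finset.card_eq_one.1 hc
  have := Finset.sum_add_sum_compl (a ∪ b) s
  rw [Finset.sum_union hd, ha0, hb0, hk, h.sum, Finset.sum_singleton] at this
  exact h.ne k (by simpa using this)

/-- An isomorphism preserves incidence, hence permutes the indices, and then transports the
relation. Conversely, pentads with the same relation are linearly equivalent up to translation. -/
theorem iso_iff (h : IsPentad x s) (h' : IsPentad y r) :
    (pentadConfig x).Iso (pentadConfig y) ↔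
      ∃ (σ : Equiv.Perm (Fin 5)) (c : ℂ), c ≠ 0 ∧ ∀ i, r (σ i) = c * s i := by
  constructor
  · rintro ⟨φ, hp, hl⟩
    have hinj := Submodule.map_injective_of_injective (f := (φ : W →ₗ[ℂ] W')) φ.injective
    have hf : ∀ a : Duad, ∃ a' : Duad, Submodule.map (φ : W →ₗ[ℂ] W') (flat x a.1) =
        flat y a'.1 := by
      intro a
      have : Submodule.map (φ : W →ₗ[ℂ] W') (flat x a.1) ∈ (pentadConfig y).points := by
        rw [hp]
        exact ⟨_, ⟨a.1, a.2, rfl⟩, rfl⟩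
      obtain ⟨a', h1, h2⟩ := this
      exact ⟨⟨a', h1⟩, h2⟩
    have hg : ∀ b : Duad, ∃ b' : Duad, Submodule.map (φ : W →ₗ[ℂ] W') (flat x b.1ᶜ) =
        flat y b'.1ᶜ := by
      intro b
      have : Submodule.map (φ : W →ₗ[ℂ] W') (flat x b.1ᶜ) ∈ (pentadConfig y).lines := by
        rw [hl]
        exact ⟨_, mem_lines_iff.2 ⟨b.1, b.2, rfl⟩, rfl⟩
      obtain ⟨b', h1, h2⟩ := mem_lines_iff.1 this
      exact ⟨⟨b', h1⟩, h2⟩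
    choose f hf using hf
    choose g hg using hg
    have hfg : ∀ a b : Duad, (Disjoint a.1 b.1 ∨ (a = b ∧ ∑ i ∈ b.1, s i = 0)) ↔
        (Disjoint (f a).1 (g b).1 ∨ (f a = g b ∧ ∑ i ∈ (g b).1, r i = 0)) := by
      intro a b
      have e1 := h.flat_le_flat_compl_iff a.2 b.2
      have e2 := h'.flat_le_flat_compl_iff (f a).2 (g b).2
      rw [← Subtype.ext_iff] at e1 e2
      rw [← e1, ← e2, ← hf, ← hg, Submodule.map_le_map_iff_of_injective φ.injective]
    have hfi : Function.Injective f := fun a b e =>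
      Subtype.ext (h.flat_injOn a.2 b.2 (hinj (by rw [hf, hf, e])))
    have hgi : Function.Injective g := by
      intro a b e
      have e' : flat x a.1ᶜ = flat x b.1ᶜ := hinj (by rw [hg, hg, e])
      have key : ∀ c : Duad, Disjoint c.1 a.1 → flat x c.1 ≤ flat x b.1ᶜ := fun c hc => by
        rw [← e']
        exact (h.flat_le_flat_compl_iff c.2 a.2).2 (Or.inl hc)
      by_contra hne
      obtain ⟨c, hc1, hc2, hc3⟩ : ∃ c : Duad, Disjoint c.1 a.1 ∧ ¬ Disjoint c.1 b.1 ∧ c ≠ b := by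
        clear e e' key
        revert a b
        decide
      obtain h1 | h1 := (h.flat_le_flat_compl_iff c.2 b.2).1 (key c hc1)
      · exact hc2 h1
      · exact hc3 (Subtype.ext h1.1)
    obtain ⟨σ, hσ⟩ := Duad.exists_perm_of_incident_iff
      (p := fun b => ∑ i ∈ b.1, s i = 0) (p' := fun b => ∑ i ∈ b.1, r i = 0)
      (Equiv.ofBijective f (Finite.injective_iff_bijective.1 hfi))
      (Equiv.ofBijective g (Finite.injective_iff_bijective.1 hgi))
      (fun a b ha hb => h.not_disjoint_of_sum_eq_zero a.2 b.2 ha hb)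
      (fun a b ha hb => h'.not_disjoint_of_sum_eq_zero a.2 b.2 ha hb) hfg
    obtain ⟨c, hc, hcs⟩ := h.eq_smul_of_map_flat (h'.comp σ) φ fun a ha => by
      rw [flat_comp, ← hσ ⟨a, ha⟩]
      exact hf ⟨a, ha⟩
    exact ⟨σ, c, hc, hcs⟩
  · rintro ⟨σ, c, hc, hcs⟩
    have h1 : IsPentad x (r ∘ σ) := by
      have := h.smul hc
      rwa [← funext hcs] at this
    have hmap := fun T => h1.map_equiv_flat (h'.comp σ) T
    have himg : ∀ (n : ℕ), {l | ∃ T : Finset (Fin 5), T.card = n ∧ l = flat y T} =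
        Submodule.map (h1.equiv (h'.comp σ) : W →ₗ[ℂ] W') ''
          {l | ∃ T : Finset (Fin 5), T.card = n ∧ l = flat x T} := by
      intro n
      ext l
      constructor
      · rintro ⟨T, hT, rfl⟩
        refine ⟨_, ⟨T.map σ.symm.toEmbedding, by simpa using hT, rfl⟩, ?_⟩
        rw [hmap, flat_comp, Finset.map_map]
        congr 1
        ext i
        simp
      · rintro ⟨_, ⟨T, hT, rfl⟩, rfl⟩
        exact ⟨T.map σ.toEmbedding, by simpa using hT, by rw [hmap, flat_comp]⟩
    exact ⟨h1.equiv (h'.comp σ), himg 2, himg 3⟩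

end IsPentad

/-- Every Desargues configuration is the configuration of a pentad. -/
theorem Configuration.IsDesargues.exists_pentad {D : Configuration W} (hD : D.IsDesargues) :
    ∃ (x : Fin 5 → W) (s : Fin 5 → ℂ), IsPentad x s ∧ D = pentadConfig x := by
  obtain ⟨hW, O, A, B, hO, hA, hB, hAt, hBt, -, hOAB, hOA, hOB, hpts, hlns⟩ := hD
  have hspan : ∀ p : Submodule ℂ W, Module.finrank ℂ p = 1 →
      ∃ v, v ≠ 0 ∧ p = Submodule.span ℂ {v} := by
    intro p hp
    obtain ⟨⟨v, hv⟩, hv0, hvs⟩ := finrank_eq_one_iff'.1 hp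
    refine ⟨v, fun h => hv0 (Subtype.ext h), le_antisymm (fun w hw => ?_) ?_⟩
    · obtain ⟨c, hc⟩ := hvs ⟨w, hw⟩
      exact Submodule.mem_span_singleton.2 ⟨c, congrArg Subtype.val hc⟩
    · rwa [Submodule.span_singleton_le_iff_mem]
  obtain ⟨o, ho, rfl⟩ := hspan O hO
  simp only [Submodule.span_singleton_le_iff_mem] at hOAB hOA hOB
  have hab : ∀ i, ∃ a b : W, A i = Submodule.span ℂ {a} ∧ B i = Submodule.span ℂ {b} ∧
      o = b - a := by
    intro i
    obtain ⟨a, -, ha⟩ := hspan (A i) (hA i)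
    obtain ⟨b, -, hb⟩ := hspan (B i) (hB i)
    -- A second index gives sides through `A i` and `B i`. As `O` is on neither, both coefficients
    -- of `o` are nonzero and can be absorbed into the representatives.
    obtain ⟨j, hji⟩ := exists_ne i
    have hij := hji.symm
    have hoAB := hOAB i
    obtain ⟨u, hu, v, hv, huv⟩ := Submodule.mem_sup.1 hoAB
    rw [ha] at hu
    rw [hb] at hv
    obtain ⟨c, rfl⟩ := Submodule.mem_span_singleton.1 hu
    obtain ⟨d, rfl⟩ := Submodule.mem_span_singleton.1 hv
    have hc : c ≠ 0 := by
      rintro rfl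
      refine hOB i j hij (Submodule.mem_sup_left ?_)
      rw [← huv, zero_smul, zero_add, hb]
      exact hv
    have hd : d ≠ 0 := by
      rintro rfl
      refine hOA i j hij (Submodule.mem_sup_left ?_)
      rw [← huv, zero_smul, add_zero, ha]
      exact hu
    refine ⟨(-c) • a, d • b, ?_, ?_, ?_⟩
    · rw [ha, Submodule.span_singleton_smul_eq (IsUnit.mk0 _ (neg_ne_zero.2 hc))]
    · rw [hb, Submodule.span_singleton_smul_eq (IsUnit.mk0 _ hd)]
    · rw [← huv, neg_smul]
      abel
  choose a b hAa hBb hoab using hab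
  have hspan3 : ∀ (v : Fin 3 → W), Submodule.span ℂ {v 0} ⊔ Submodule.span ℂ {v 1} ⊔
      Submodule.span ℂ {v 2} = Submodule.span ℂ (Set.range v) := by
    intro v
    rw [← Submodule.span_union, ← Submodule.span_union]
    congr 1
    ext w
    simp [Fin.exists_fin_succ, eq_comm]
    tauto
  have hlin : ∀ v : Fin 3 → W, Submodule.span ℂ {v 0} ⊔ Submodule.span ℂ {v 1} ⊔
      Submodule.span ℂ {v 2} = ⊤ → LinearIndependent ℂ v := fun v hv =>
    linearIndependent_of_top_le_span_of_card_eq_finrank (by rw [← hspan3 v, hv]) (by simp [hW])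
  rw [hAa, hAa, hAa] at hAt
  rw [hBb, hBb, hBb] at hBt
  have hal := hlin a hAt
  have hbl := hlin b hBt
  rw [hspan3] at hAt
  obtain ⟨c, hc⟩ := (Submodule.mem_span_range_iff_exists_fun ℂ).1
    (hAt ▸ Submodule.mem_top : o ∈ Submodule.span ℂ (Set.range a))
  have hb' : ∀ i, b i = a i + o := fun i => by rw [hoab i]; abel
  have hc0 : ∀ i, c i ≠ 0 := by
    intro i hi
    obtain ⟨j, k, hjk, hij, hik⟩ : ∃ j k : Fin 3, j ≠ k ∧ i ≠ j ∧ i ≠ k := by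
      clear hi
      revert i
      decide
    refine hOA j k hjk ?_
    have huniv : (Finset.univ : Finset (Fin 3)) = {i, j, k} := by
      clear hi
      revert i j k
      decide
    rw [← hc, huniv, Finset.sum_insert (by simp [hij, hik]), Finset.sum_pair hjk, hi, zero_smul,
      zero_add, hAa, hAa]
    exact Submodule.add_mem_sup (Submodule.smul_mem _ _ (Submodule.mem_span_singleton_self _))
      (Submodule.smul_mem _ _ (Submodule.mem_span_singleton_self _))
  -- Since `b i = a i + o`, one has `∑ c i • b i = (1 + ∑ c i) • o`, and the `b i` are independent.
  have hcs : 1 + ∑ i, c i ≠ 0 := by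
    intro h0
    have hz : ∑ i, c i • b i = 0 := by
      simp only [hb', smul_add, Finset.sum_add_distrib, hc, ← Finset.sum_smul]
      rw [← one_smul ℂ o, smul_smul, mul_one, ← add_smul, h0, zero_smul]
    exact hc0 0 (Fintype.linearIndependent_iff.1 hbl c hz 0)
  -- The differences with `x 3` are the `a i`, those with `x 4` are the `b i`, and `x 3 - x 4 = o`.
  -- The relation is `o = ∑ c i • a i`; the coefficient of the zero vector `x 3` is chosen to make
  -- the sum zero.
  let x : Fin 5 → W := ![a 0, a 1, a 2, 0, -o]
  let s : Fin 5 → ℂ := ![c 0, c 1, c 2, -(1 + ∑ i, c i), 1]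
  have hx : IsPentad x s :=
    { ne := by
        intro i
        fin_cases i
        · exact hc0 0
        · exact hc0 1
        · exact hc0 2
        · exact neg_ne_zero.2 hcs
        · exact one_ne_zero
      sum := by
        simp only [s, Fin.sum_univ_five, Fin.sum_univ_three, Matrix.cons_val]
        ring
      rel := by
        rw [Fin.sum_univ_three] at hc
        simp only [s, x, Fin.sum_univ_five, Matrix.cons_val, smul_zero, one_smul]
        rw [← hc]
        abel
      unique := by
        intro t ht ht'
        rw [Fin.sum_univ_three] at hc
        simp only [x, Fin.sum_univ_five, Matrix.cons_val, smul_zero] at ht'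
        rw [Fin.sum_univ_five] at ht
        have hz := Fintype.linearIndependent_iff.1 hal
          ![t 0 - t 4 * c 0, t 1 - t 4 * c 1, t 2 - t 4 * c 2] (by
            rw [Fin.sum_univ_three]
            simp only [Matrix.cons_val]
            rw [← ht', ← hc]
            module)
        have h0 : t 0 - t 4 * c 0 = 0 := hz 0
        have h1 : t 1 - t 4 * c 1 = 0 := hz 1
        have h2 : t 2 - t 4 * c 2 = 0 := hz 2
        refine ⟨t 4, fun i => ?_⟩
        fin_cases i
        · simpa [s] using sub_eq_zero.1 h0
        · simpa [s] using sub_eq_zero.1 h1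
        · simpa [s] using sub_eq_zero.1 h2
        · simp only [s, Fin.reduceFinMk, Matrix.cons_val, Fin.sum_univ_three]
          linear_combination ht - h0 - h1 - h2
        · simp [s]
      finrank := hW }
  have hO' : flat x {3, 4} = Submodule.span ℂ {o} := by
    rw [flat_pair x (by decide)]
    simp [x]
  have hA' : (fun i => flat x {emb i, 3}) = A := by
    funext i
    rw [flat_pair x (by revert i; decide), hAa]
    fin_cases i <;> simp [x, emb]
  have hB' : (fun i => flat x {emb i, 4}) = B := by
    funext i
    rw [flat_pair x (by revert i; decide), hBb, hb']
    fin_cases i <;> simp [x, emb]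
  refine ⟨x, s, hx, ?_⟩
  have h1 := hx.points_eq
  have h2 := hx.lines_eq
  have hA'' : ∀ i : Fin 3, flat x {emb i, 3} = A i := congrFun hA'
  have hB'' : ∀ i : Fin 3, flat x {emb i, 4} = B i := congrFun hB'
  rw [hA', hB', hO', ← hpts] at h1
  rw [hA', hB'] at h2
  simp only [hA'', hB''] at h2
  rw [← hlns] at h2
  cases D
  simp only [pentadConfig, Configuration.mk.injEq] at h1 h2 ⊢
  exact ⟨h1.symm, h2.symm⟩

end PentadConfig

/-! ### The weights and the pentad of a plane -/

/-- Vectors that represent the points `eᵢ` and have sum zero. -/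
def circVec : Fin 5 → Fin 4 → ℂ :=
  ![![1, 0, 0, 0], ![0, 1, 0, 0], ![0, 0, 1, 0], ![0, 0, 0, 1], ![-1, -1, -1, -1]]

theorem frame_eq (i : Fin 5) : frame i = Submodule.span ℂ {circVec i} := by
  have h : ∀ i, ∃ a : ℂ, a ≠ 0 ∧ circVec i = a • frameVec i := by
    intro i
    by_cases hi : i = 4
    · refine ⟨-1, neg_ne_zero.2 one_ne_zero, ?_⟩
      subst hi
      simp [circVec, frameVec]
    · refine ⟨1, one_ne_zero, ?_⟩
      rw [one_smul]
      fin_cases i <;> simp [circVec, frameVec] at hi ⊢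
  obtain ⟨a, ha, h⟩ := h i
  rw [frame, h, Submodule.span_singleton_smul_eq (IsUnit.mk0 _ ha)]

theorem sum_smul_circVec (u : Fin 5 → ℂ) :
    ∑ i, u i • circVec i = ![u 0 - u 4, u 1 - u 4, u 2 - u 4, u 3 - u 4] := by
  funext j
  rw [Finset.sum_apply]
  fin_cases j <;> simp [Fin.sum_univ_five, circVec] <;> ring

theorem sum_circVec : ∑ i, circVec i = 0 := by
  have := sum_smul_circVec 1
  simp only [Pi.one_apply, one_smul, sub_self] at this
  rw [this]
  funext j
  fin_cases j <;> rfl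

theorem circVec_ne_zero (i : Fin 5) : circVec i ≠ 0 := by
  intro h
  fin_cases i
  · simpa [circVec] using congrFun h 0
  · simpa [circVec] using congrFun h 1
  · simpa [circVec] using congrFun h 2
  · simpa [circVec] using congrFun h 3
  · simpa [circVec] using congrFun h 0

theorem eq_of_sum_smul_circVec {u : Fin 5 → ℂ} (h : ∑ i, u i • circVec i = 0) (i : Fin 5) :
    u i = u 4 := by
  rw [sum_smul_circVec] at h
  fin_cases i
  · simpa [sub_eq_zero] using congrFun h 0
  · simpa [sub_eq_zero] using congrFun h 1
  · simpa [sub_eq_zero] using congrFun h 2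
  · simpa [sub_eq_zero] using congrFun h 3
  · rfl

theorem eq_sum_smul_circVec (v : Fin 4 → ℂ) :
    v = ∑ i, (![v 0, v 1, v 2, v 3, 0] : Fin 5 → ℂ) i • circVec i := by
  rw [sum_smul_circVec]
  funext j
  fin_cases j <;> simp

/-- The linear form `∑ cᵢ xᵢ`. -/
def form (c : Fin 4 → ℂ) : (Fin 4 → ℂ) →ₗ[ℂ] ℂ := ∑ i, c i • LinearMap.proj i

theorem form_apply (c v : Fin 4 → ℂ) : form c v = ∑ i, c i * v i := by simp [form]

/-- The values of a linear form on the vectors `circVec i`. -/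
def weight (c : Fin 4 → ℂ) (i : Fin 5) : ℂ := form c (circVec i)

theorem weight_zero (c : Fin 4 → ℂ) : weight c 0 = c 0 := by
  simp [weight, form_apply, circVec, Fin.sum_univ_four]

theorem weight_one (c : Fin 4 → ℂ) : weight c 1 = c 1 := by
  simp [weight, form_apply, circVec, Fin.sum_univ_four]

theorem weight_two (c : Fin 4 → ℂ) : weight c 2 = c 2 := by
  simp [weight, form_apply, circVec, Fin.sum_univ_four]

theorem weight_three (c : Fin 4 → ℂ) : weight c 3 = c 3 := by
  simp [weight, form_apply, circVec, Fin.sum_univ_four]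

theorem weight_four (c : Fin 4 → ℂ) : weight c 4 = -(c 0 + c 1 + c 2 + c 3) := by
  simp [weight, form_apply, circVec, Fin.sum_univ_four]
  ring

theorem sum_weight (c : Fin 4 → ℂ) : ∑ i, weight c i = 0 := by
  simp only [weight]
  rw [← map_sum, sum_circVec, map_zero]

theorem weight_smul (a : ℂ) (c : Fin 4 → ℂ) (i : Fin 5) : weight (a • c) i = a * weight c i := by
  simp [weight, form_apply, Finset.mul_sum, mul_assoc]

theorem weight_of_sum_eq_zero {s : Fin 5 → ℂ} (hs : ∑ i, s i = 0) :
    weight ![s 0, s 1, s 2, s 3] = s := by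
  funext i
  rw [Fin.sum_univ_five] at hs
  fin_cases i
  · exact weight_zero _
  · exact weight_one _
  · exact weight_two _
  · exact weight_three _
  · refine (weight_four _).trans ?_
    simp only [Matrix.cons_val, Fin.reduceFinMk]
    linear_combination -hs

theorem mem_plane {α : DualSpace} {v : Fin 4 → ℂ} : v ∈ α.plane ↔ form α.coord v = 0 := Iff.rfl

theorem forall_not_frame_le_iff (α : DualSpace) :
    (∀ i, ¬ frame i ≤ α.plane) ↔ ∀ i, weight α.coord i ≠ 0 := by
  refine forall_congr' fun i => not_congr ?_
  rw [frame_eq, Submodule.span_singleton_le_iff_mem]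
  rfl

/-- The five coefficients of a plane of `U`. -/
def U.weight (α : U) : Fin 5 → ℂ := DesarguesModuli.weight α.1.coord

theorem U.weight_ne_zero (α : U) (i : Fin 5) : α.weight i ≠ 0 :=
  (forall_not_frame_le_iff α.1).1 α.2 i

theorem U.sum_weight (α : U) : ∑ i, α.weight i = 0 := DesarguesModuli.sum_weight _

theorem mem_P12_iff (α : U) : α ∈ P12 ↔ α.weight 0 + α.weight 1 = 0 := by
  rw [U.weight, weight_zero, weight_one]
  change Submodule.span ℂ _ ≤ _ ↔ _
  rw [Submodule.span_singleton_le_iff_mem, mem_plane, form_apply, Fin.sum_univ_four]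
  simp

theorem DualSpace.exists_coord_eq {c : Fin 4 → ℂ} (hc : c ≠ 0) :
    ∃ (α : DualSpace) (a : ℂ), a ≠ 0 ∧ α.coord = a • c := by
  obtain ⟨a, ha⟩ := Projectivization.exists_smul_eq_mk_rep ℂ c hc
  exact ⟨Projectivization.mk ℂ c hc, a, a.ne_zero, ha.symm⟩

theorem U.exists_coord_eq {c : Fin 4 → ℂ} (hc : ∀ i, DesarguesModuli.weight c i ≠ 0) :
    ∃ (α : U) (a : ℂ), a ≠ 0 ∧ α.1.coord = a • c := by
  obtain ⟨α, a, ha, h⟩ := DualSpace.exists_coord_eq (c := c) (by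
    rintro rfl
    exact hc 0 (by simp [weight_zero]))
  refine ⟨⟨α, (forall_not_frame_le_iff α).2 fun i => ?_⟩, a, ha, h⟩
  rw [h, weight_smul]
  exact mul_ne_zero ha (hc i)

theorem U.exists_weight_eq {s : Fin 5 → ℂ} (hs : ∀ i, s i ≠ 0) (hs0 : ∑ i, s i = 0) :
    ∃ (α : U) (a : ℂ), a ≠ 0 ∧ ∀ i, α.weight i = a * s i := by
  obtain ⟨α, a, ha, h⟩ := U.exists_coord_eq (c := ![s 0, s 1, s 2, s 3]) (by
    rwa [weight_of_sum_eq_zero hs0])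
  exact ⟨α, a, ha, fun i => by rw [U.weight, h, weight_smul, weight_of_sum_eq_zero hs0]⟩

/-- The pentad whose configuration is `desargues α`. -/
def U.pentad (α : U) (i : Fin 5) : α.1.plane :=
  -- The multiple of `circVec i` at which the form takes the value 1, translated into the plane by
  -- the last such vector.
  ⟨(α.weight i)⁻¹ • circVec i - (α.weight 4)⁻¹ • circVec 4, by
    have h := α.weight_ne_zero
    rw [mem_plane, map_sub, map_smul, map_smul]
    change (α.weight i)⁻¹ * α.weight i - (α.weight 4)⁻¹ * α.weight 4 = 0
    rw [inv_mul_cancel₀ (h i), inv_mul_cancel₀ (h 4), sub_self]⟩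

theorem U.coe_sum_smul_pentad (α : U) {t : Fin 5 → ℂ} (ht : ∑ i, t i = 0) :
    ((∑ i, t i • α.pentad i : α.1.plane) : Fin 4 → ℂ) =
      ∑ i, (t i * (α.weight i)⁻¹) • circVec i := by
  simp [U.pentad, smul_sub, Finset.sum_sub_distrib, ← Finset.sum_smul, ht, mul_smul]

theorem U.finrank_plane (α : U) : Module.finrank ℂ α.1.plane = 3 := by
  have hne : form α.1.coord ≠ 0 := fun h => α.weight_ne_zero 0 (by
    rw [U.weight, DesarguesModuli.weight, h, LinearMap.zero_apply])
  have := Module.Dual.finrank_ker_add_one_of_ne_zero hne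
  rw [Module.finrank_fin_fun] at this
  have h' : Module.finrank ℂ (LinearMap.ker (form α.1.coord)) = 3 := by omega
  exact h'

theorem U.isPentad (α : U) : IsPentad α.pentad α.weight where
  ne := α.weight_ne_zero
  sum := α.sum_weight
  rel := by
    refine Subtype.ext ?_
    rw [α.coe_sum_smul_pentad α.sum_weight]
    simp [α.weight_ne_zero, sum_circVec]
  unique t ht ht' := by
    have h := α.coe_sum_smul_pentad ht
    rw [ht'] at h
    refine ⟨t 4 * (α.weight 4)⁻¹, fun i => ?_⟩
    rw [← eq_of_sum_smul_circVec (u := fun i => t i * (α.weight i)⁻¹) h.symm i]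
    simp [α.weight_ne_zero i]
  finrank := α.finrank_plane

/-- With `t i = u i * weight i`, the condition `∑ t i = 0` says exactly that `∑ u i • circVec i`
lies in the plane. -/
theorem U.flat_pentad (α : U) (T : Finset (Fin 5)) :
    flat α.pentad T =
      Submodule.comap α.1.plane.subtype (Submodule.span ℂ (circVec '' (T : Set (Fin 5)))) := by
  ext v
  rw [Submodule.mem_comap, Submodule.mem_span_image_finset_iff_exists_fun']
  constructor
  · rintro ⟨t, ht, ht', rfl⟩
    refine ⟨fun i => t i * (α.weight i)⁻¹, ?_⟩
    rw [Submodule.subtype_apply, α.coe_sum_smul_pentad ht]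
    exact Finset.sum_subset (Finset.subset_univ T) fun i _ hi => by simp [ht' i hi]
  · rintro ⟨u, hu⟩
    rw [Submodule.subtype_apply] at hu
    have hT : ∀ g : Fin 5 → ℂ, ∑ i, (if i ∈ T then g i else 0) = ∑ i ∈ T, g i := fun g => by simp
    have h0 : ∑ i, (if i ∈ T then u i * α.weight i else 0) = 0 := by
      rw [hT, ← mem_plane.1 v.2, ← hu, map_sum]
      simp only [map_smul]
      rfl
    refine ⟨fun i => if i ∈ T then u i * α.weight i else 0, h0, fun i hi => if_neg hi, ?_⟩
    refine Subtype.ext ?_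
    rw [α.coe_sum_smul_pentad h0, ← hu, ← Finset.sum_subset (Finset.subset_univ T)]
    · exact Finset.sum_congr rfl fun i hi => by
        rw [if_pos hi, mul_inv_cancel_right₀ (α.weight_ne_zero i)]
    · intro i _ hi
      rw [if_neg hi, zero_mul, zero_smul]

theorem desargues_eq (α : U) : desargues α = pentadConfig α.pentad := by
  have h2 : ∀ i j, Submodule.comap α.1.plane.subtype (frame i ⊔ frame j) =
      flat α.pentad {i, j} := by
    intro i j
    rw [α.flat_pentad, frame_eq, frame_eq, Finset.coe_pair, Set.image_pair, Submodule.span_insert]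
  have h3 : ∀ i j k, Submodule.comap α.1.plane.subtype (frame i ⊔ frame j ⊔ frame k) =
      flat α.pentad {i, j, k} := by
    intro i j k
    rw [α.flat_pentad, frame_eq, frame_eq, frame_eq, Finset.coe_insert, Finset.coe_pair,
      Set.image_insert_eq, Set.image_pair, Submodule.span_insert, Submodule.span_insert, sup_assoc]
  simp only [desargues, pentadConfig, h2, h3, Configuration.mk.injEq, Finset.card_eq_two,
    Finset.card_eq_three]
  constructor
  · ext p
    constructor
    · rintro ⟨i, j, h, rfl⟩
      exact ⟨_, ⟨i, j, h, rfl⟩, rfl⟩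
    · rintro ⟨_, ⟨i, j, h, rfl⟩, rfl⟩
      exact ⟨i, j, h, rfl⟩
  · ext p
    constructor
    · rintro ⟨i, j, k, h, h', h'', rfl⟩
      exact ⟨_, ⟨i, j, k, h, h', h'', rfl⟩, rfl⟩
    · rintro ⟨_, ⟨i, j, k, h, h', h'', rfl⟩, rfl⟩
      exact ⟨i, j, k, h, h', h'', rfl⟩

/-! ### Orbits of planes and isomorphism classes -/

/-- The linear map that permutes the vectors `circVec i`. -/
def permMap (σ : Equiv.Perm (Fin 5)) : (Fin 4 → ℂ) →ₗ[ℂ] (Fin 4 → ℂ) :=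
  ∑ i : Fin 4, (LinearMap.proj i : (Fin 4 → ℂ) →ₗ[ℂ] ℂ).smulRight (circVec (σ i.castSucc))

theorem permMap_circVec (σ : Equiv.Perm (Fin 5)) (i : Fin 5) :
    permMap σ (circVec i) = circVec (σ i) := by
  have key : ∀ g : Fin 5 → Fin 4 → ℂ, ∑ j, g j = 0 →
      ∑ j : Fin 4, circVec i j • g j.castSucc = g i := by
    intro g hg
    rw [Fin.sum_univ_five] at hg
    have h4 := eq_neg_of_add_eq_zero_right hg
    rw [Fin.sum_univ_four]
    fin_cases i <;> simp [circVec, h4]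
    abel
  simpa [permMap] using key (circVec ∘ σ) (by rw [← sum_circVec]; exact Equiv.sum_comp σ circVec)

theorem linearMap_ext_circVec {M : Type} [AddCommGroup M] [Module ℂ M]
    {f g : (Fin 4 → ℂ) →ₗ[ℂ] M} (h : ∀ i, f (circVec i) = g (circVec i)) : f = g := by
  refine LinearMap.ext fun v => ?_
  rw [eq_sum_smul_circVec v]
  simp only [map_sum, map_smul, h]

/-- The linear automorphism that permutes the vectors `circVec i`. -/
def permEquiv (σ : Equiv.Perm (Fin 5)) : (Fin 4 → ℂ) ≃ₗ[ℂ] (Fin 4 → ℂ) :=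
  LinearEquiv.ofLinearMap (permMap σ) (permMap σ⁻¹)
    (linearMap_ext_circVec fun i => by simp [permMap_circVec])
    (linearMap_ext_circVec fun i => by simp [permMap_circVec])

theorem permEquiv_circVec (σ : Equiv.Perm (Fin 5)) (i : Fin 5) :
    permEquiv σ (circVec i) = circVec (σ i) := permMap_circVec σ i

theorem permEquiv_mem_frameGroup (σ : Equiv.Perm (Fin 5)) : permEquiv σ ∈ frameGroup := by
  refine ⟨σ, fun i => ?_⟩
  rw [frame_eq, frame_eq, Submodule.map_span, Set.image_singleton]
  exact congrArg (fun v => Submodule.span ℂ {v}) (permEquiv_circVec σ i)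

/-- Two planes are in the same orbit if and only if their coefficients are the same up to a
permutation and a scalar. -/
theorem q_eq_iff (α β : U) :
    q α = q β ↔
      ∃ (σ : Equiv.Perm (Fin 5)) (c : ℂ), c ≠ 0 ∧ ∀ i, β.weight (σ i) = c * α.weight i := by
  refine (Quotient.eq (r := orbitSetoid)).trans ?_
  constructor
  · rintro ⟨A, ⟨σ, hσ⟩, hA⟩
    have hex : ∀ i, ∃ l : ℂ, A (circVec i) = l • circVec (σ i) := by
      intro i
      have h : A (circVec i) ∈ frame (σ i) := by
        rw [← hσ i, frame_eq]
        exact Submodule.mem_map_of_mem (Submodule.mem_span_singleton_self _)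
      rw [frame_eq] at h
      obtain ⟨l, hl⟩ := Submodule.mem_span_singleton.1 h
      exact ⟨l, hl.symm⟩
    choose l hl using hex
    -- The image under `A` of the relation `∑ circVec i = 0`. The only relations of the `circVec i`
    -- are the constant ones, so all the `l i` agree.
    have hl' : ∑ i, l (σ.symm i) • circVec i = 0 := by
      rw [← Equiv.sum_comp σ]
      simp only [Equiv.symm_apply_apply, ← hl]
      rw [← map_sum, sum_circVec, map_zero]
    have hconst : ∀ i, l i = l (σ.symm 4) := fun i => by
      simpa using eq_of_sum_smul_circVec hl' (σ i)
    set m := l (σ.symm 4)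
    have hm : m ≠ 0 := by
      intro h0
      have := hl 0
      rw [hconst, h0, zero_smul] at this
      exact circVec_ne_zero 0 (A.map_eq_zero_iff.1 this)
    have hv : ∀ v, form α.1.coord v = 0 → form β.1.coord (A v) = 0 := by
      intro v hv
      have : A v ∈ β.1.plane := by
        rw [← hA]
        exact Submodule.mem_map_of_mem (mem_plane.2 hv)
      exact this
    -- The form of `β` composed with `A` vanishes on the plane of `α`, so it is proportional to the
    -- form of `α`; the ratio is read off at `circVec 0` and divided by `m`.
    refine ⟨σ, m⁻¹ * (form β.1.coord (A (circVec 0)) * (α.weight 0)⁻¹), ?_, fun i => ?_⟩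
    · refine mul_ne_zero (inv_ne_zero hm) (mul_ne_zero ?_ (inv_ne_zero (α.weight_ne_zero 0)))
      rw [hl, hconst, map_smul]
      exact mul_ne_zero hm (β.weight_ne_zero _)
    · have h1 := hv (α.weight 0 • circVec i - α.weight i • circVec 0) (by
        rw [map_sub, map_smul, map_smul]
        change α.weight 0 * α.weight i - α.weight i * α.weight 0 = 0
        ring)
      rw [map_sub, map_smul, map_smul, map_sub, map_smul, map_smul, hl i, hconst i, map_smul] at h1
      change α.weight 0 * (m * β.weight (σ i)) - _ = 0 at h1
      have h0 := α.weight_ne_zero 0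
      field_simp
      simp only [smul_eq_mul] at h1
      linear_combination h1
  · rintro ⟨σ, c, hc, h⟩
    refine ⟨permEquiv σ, permEquiv_mem_frameGroup σ, ?_⟩
    have hf : (form β.1.coord).comp (permEquiv σ : (Fin 4 → ℂ) →ₗ[ℂ] (Fin 4 → ℂ)) =
        c • form α.1.coord := by
      refine linearMap_ext_circVec fun i => ?_
      change form β.1.coord (permEquiv σ (circVec i)) = c * α.weight i
      rw [permEquiv_circVec, ← h]
      rfl
    ext v
    rw [Submodule.mem_map_equiv, mem_plane, mem_plane]
    have := LinearMap.congr_fun hf ((permEquiv σ).symm v)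
    simp only [LinearMap.comp_apply, LinearEquiv.coe_coe, LinearEquiv.apply_symm_apply,
      LinearMap.smul_apply, smul_eq_mul] at this
    rw [this, mul_eq_zero, or_iff_right hc]

theorem iso_desargues_iff (α β : U) : (desargues α).Iso (desargues β) ↔ q α = q β := by
  rw [desargues_eq, desargues_eq, α.isPentad.iso_iff β.isPentad, q_eq_iff]

theorem isSpecialDesargues_desargues_iff (α : U) :
    (desargues α).IsSpecialDesargues ↔ ∃ i j, i ≠ j ∧ α.weight i + α.weight j = 0 := by
  rw [desargues_eq, α.isPentad.isSpecialDesargues_iff]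
  constructor
  · rintro ⟨b, hb, h⟩
    obtain ⟨i, j, hij, rfl⟩ := Finset.card_eq_two.1 hb
    exact ⟨i, j, hij, by rwa [Finset.sum_pair hij] at h⟩
  · rintro ⟨i, j, hij, h⟩
    exact ⟨{i, j}, Finset.card_pair hij, by rwa [Finset.sum_pair hij]⟩

/-- Permutations move the pair `{0, 1}` to any other pair of indices. -/
theorem q_mem_image_P12_iff (α : U) :
    q α ∈ q '' P12 ↔ ∃ i j, i ≠ j ∧ α.weight i + α.weight j = 0 := by
  constructor
  · rintro ⟨β, hβ, h⟩
    rw [mem_P12_iff] at hβ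
    obtain ⟨σ, c, hc, hσ⟩ := (q_eq_iff β α).1 h
    refine ⟨σ 0, σ 1, σ.injective.ne (by decide), ?_⟩
    rw [hσ, hσ, ← mul_add, hβ, mul_zero]
  · rintro ⟨i, j, hij, h⟩
    obtain ⟨σ, h0, h1⟩ : ∃ σ : Equiv.Perm (Fin 5), σ 0 = i ∧ σ 1 = j := by
      have hx : Equiv.swap 0 i 1 ≠ i := fun h' => by
        rw [Equiv.swap_apply_eq_iff, Equiv.swap_apply_right] at h'
        exact absurd h' (by decide)
      refine ⟨Equiv.swap (Equiv.swap 0 i 1) j * Equiv.swap 0 i, ?_, ?_⟩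
      · rw [Equiv.Perm.mul_apply, Equiv.swap_apply_left, Equiv.swap_apply_of_ne_of_ne hx.symm hij]
      · rw [Equiv.Perm.mul_apply, Equiv.swap_apply_left]
    obtain ⟨β, a, ha, hβ⟩ := U.exists_weight_eq (s := α.weight ∘ σ)
      (fun i => α.weight_ne_zero _) (by rw [← α.sum_weight]; exact Equiv.sum_comp σ α.weight)
    refine ⟨β, ?_, ?_⟩
    · rw [mem_P12_iff, hβ, hβ]
      simp only [Function.comp_apply, h0, h1]
      rw [← mul_add, h, mul_zero]
    · exact (q_eq_iff β α).2 ⟨σ, a⁻¹, inv_ne_zero ha, fun i => by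
        rw [hβ, inv_mul_cancel_left₀ ha, Function.comp_apply]⟩

theorem exists_iso_desargues {W : Type} [AddCommGroup W] [Module ℂ W] {D : Configuration W}
    (hD : D.IsSpecialDesargues) : ∃ α ∈ P12, D.Iso (desargues α) := by
  obtain ⟨x, s, hx, rfl⟩ := hD.1.exists_pentad
  obtain ⟨b, hb, h⟩ := hx.isSpecialDesargues_iff.1 hD
  obtain ⟨α, a, ha, hα⟩ := U.exists_weight_eq hx.ne hx.sum
  obtain ⟨i, j, hij, rfl⟩ := Finset.card_eq_two.1 hb
  rw [Finset.sum_pair hij] at h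
  obtain ⟨β, hβ, hq⟩ := (q_mem_image_P12_iff α).2
    ⟨i, j, hij, by rw [hα, hα, ← mul_add, h, mul_zero]⟩
  obtain ⟨σ, c, hc, hσ⟩ := (q_eq_iff α β).1 hq.symm
  refine ⟨β, hβ, ?_⟩
  rw [desargues_eq]
  exact (hx.iso_iff β.isPentad).2
    ⟨σ, c * a, mul_ne_zero hc ha, fun i => by rw [hσ, hα, mul_assoc]⟩

/-! ### Homogeneous polynomials and closed subsets of `U` -/

open MvPolynomial in
theorem eval_smul_of_isHomogeneous {f : MvPolynomial (Fin 4) ℂ} {d : ℕ} (hf : f.IsHomogeneous d)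
    (a : ℂ) (v : Fin 4 → ℂ) : eval (a • v) f = a ^ d * eval v f := by
  rw [eval_eq', eval_eq', Finset.mul_sum]
  refine Finset.sum_congr rfl fun m hm => ?_
  have hd : ∑ i, m i = d := by
    rw [← Finsupp.degree_eq_sum]
    exact (hf.degree_eq_sum_deg_support hm).symm
  simp only [Pi.smul_apply, smul_eq_mul, mul_pow, Finset.prod_mul_distrib, Finset.prod_pow_eq_pow_sum,
    hd]
  ring

open MvPolynomial in
/-- A cofactor of a homogeneous polynomial is homogeneous. -/
theorem isHomogeneous_of_mul_left {g h : MvPolynomial (Fin 4) ℂ} {k n : ℕ} (hg : g.IsHomogeneous k)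
    (hgh : (g * h).IsHomogeneous n) (hne : g * h ≠ 0) : h.IsHomogeneous (n - k) := by
  let _ := MvPolynomial.gradedAlgebra (σ := Fin 4) (R := ℂ)
  have hg' : g ∈ homogeneousSubmodule (Fin 4) ℂ k := hg
  have hgh' : g * h ∈ homogeneousSubmodule (Fin 4) ℂ n := hgh
  have h1 := DirectSum.decompose_of_mem_same (homogeneousSubmodule (Fin 4) ℂ) hgh'
  by_cases hk : k ≤ n
  · rw [DirectSum.coe_decompose_mul_of_left_mem_of_le _ hg' hk] at h1
    rw [← mul_left_cancel₀ (left_ne_zero_of_mul hne) h1]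
    exact (DirectSum.decompose (homogeneousSubmodule (Fin 4) ℂ) h (n - k)).2
  · rw [DirectSum.coe_decompose_mul_of_left_mem_of_not_le _ hg' hk] at h1
    exact absurd h1.symm hne

theorem eval_aeval_eq (p : Fin 4 → MvPolynomial (Fin 4) ℂ) (f : MvPolynomial (Fin 4) ℂ)
    (v : Fin 4 → ℂ) : MvPolynomial.eval v (MvPolynomial.aeval p f) =
      MvPolynomial.eval (fun i => MvPolynomial.eval v (p i)) f := by
  induction f using MvPolynomial.induction_on with
  | C a => simp
  | add g h hg hh => simp only [map_add, hg, hh]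
  | mul_X g i hg => simp only [map_mul, hg, MvPolynomial.aeval_X, MvPolynomial.eval_X]

/-- The polynomials whose values are the coefficients of planes. -/
def weightPoly : Fin 5 → MvPolynomial (Fin 4) ℂ :=
  ![.X 0, .X 1, .X 2, .X 3, -(.X 0 + .X 1 + .X 2 + .X 3)]

theorem isHomogeneous_weightPoly (i : Fin 5) : (weightPoly i).IsHomogeneous 1 := by
  have h := fun j : Fin 4 => MvPolynomial.isHomogeneous_X ℂ j
  fin_cases i
  · exact h 0
  · exact h 1
  · exact h 2
  · exact h 3
  · exact ((((h 0).add (h 1)).add (h 2)).add (h 3)).neg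

theorem eval_weightPoly (c : Fin 4 → ℂ) (i : Fin 5) :
    MvPolynomial.eval c (weightPoly i) = weight c i := by
  fin_cases i
  · exact (MvPolynomial.eval_X _).trans (weight_zero c).symm
  · exact (MvPolynomial.eval_X _).trans (weight_one c).symm
  · exact (MvPolynomial.eval_X _).trans (weight_two c).symm
  · exact (MvPolynomial.eval_X _).trans (weight_three c).symm
  · refine Eq.trans ?_ (weight_four c).symm
    simp [weightPoly]

/-- The planes of `U` at which a polynomial vanishes. -/
def vanish (f : MvPolynomial (Fin 4) ℂ) : Set U := {α | MvPolynomial.eval α.1.coord f = 0}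

theorem mem_vanish {f : MvPolynomial (Fin 4) ℂ} {α : U} :
    α ∈ vanish f ↔ MvPolynomial.eval α.1.coord f = 0 := Iff.rfl

theorem DualSpace.isClosed_iff {Z : Set DualSpace} : IsClosed Z ↔ Z ∈ DualSpace.zariskiClosed := by
  rw [← isOpen_compl_iff]
  change Zᶜᶜ ∈ DualSpace.zariskiClosed ↔ _
  rw [compl_compl]

theorem isClosed_vanish {f : MvPolynomial (Fin 4) ℂ} {d : ℕ} (hf : f.IsHomogeneous d) :
    IsClosed (vanish f) := by
  have h : IsClosed (DualSpace.zeroLocus {f}) :=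
    DualSpace.isClosed_iff.2 ⟨{f}, by rintro _ rfl; exact ⟨d, hf⟩, rfl⟩
  convert h.preimage (continuous_subtype_val : Continuous (Subtype.val : U → DualSpace))
  ext α
  simp [vanish, DualSpace.zeroLocus]

theorem exists_vanish_of_notMem {C : Set U} (hC : IsClosed C) {α : U} (hα : α ∉ C) :
    ∃ (f : MvPolynomial (Fin 4) ℂ) (d : ℕ), f.IsHomogeneous d ∧ C ⊆ vanish f ∧ α ∉ vanish f := by
  obtain ⟨Z, hZ, rfl⟩ := isClosed_induced_iff.1 hC
  obtain ⟨S, hS, rfl⟩ := DualSpace.isClosed_iff.1 hZ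
  obtain ⟨f, hf, hfα⟩ : ∃ f ∈ S, MvPolynomial.eval α.1.coord f ≠ 0 := by
    by_contra! h
    exact hα h
  obtain ⟨d, hd⟩ := hS f hf
  exact ⟨f, d, hd, fun β hβ => hβ f hf, hfα⟩

/-- The planes of `U` whose coordinates are values of the polynomials `p i`. -/
def valueSet (p : Fin 4 → MvPolynomial (Fin 4) ℂ) : Set U :=
  {α | ∃ v : Fin 4 → ℂ, α.1.coord = fun i => MvPolynomial.eval v (p i)}

/-- A nonzero complex polynomial has a nonzero value. Multiplying by the five weights keeps the
point inside `U`; linearity of `p` absorbs the scalar between homogeneous coordinates. -/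
theorem exists_mem_valueSet {p : Fin 4 → MvPolynomial (Fin 4) ℂ} (hp : ∀ i, (p i).IsHomogeneous 1)
    (hw : ∀ i, MvPolynomial.aeval p (weightPoly i) ≠ 0) {f : MvPolynomial (Fin 4) ℂ} {d : ℕ}
    (hf : f.IsHomogeneous d) (hf0 : MvPolynomial.aeval p f ≠ 0) : ∃ α ∈ valueSet p, α ∉ vanish f := by
  have hne : MvPolynomial.aeval p f * ∏ i, MvPolynomial.aeval p (weightPoly i) ≠ 0 :=
    mul_ne_zero hf0 (Finset.prod_ne_zero_iff.2 fun i _ => hw i)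
  obtain ⟨v, hv⟩ : ∃ v, MvPolynomial.eval v
      (MvPolynomial.aeval p f * ∏ i, MvPolynomial.aeval p (weightPoly i)) ≠ 0 := by
    by_contra! h
    exact hne (MvPolynomial.funext fun v => by rw [h v, map_zero])
  rw [map_mul, map_prod] at hv
  have hv2 := fun i => Finset.prod_ne_zero_iff.1 (right_ne_zero_of_mul hv) i (Finset.mem_univ i)
  have hv1 := left_ne_zero_of_mul hv
  simp only [eval_aeval_eq, eval_weightPoly] at hv1 hv2
  obtain ⟨α, a, ha, hα⟩ := U.exists_coord_eq hv2
  refine ⟨α, ⟨a • v, ?_⟩, ?_⟩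
  · rw [hα]
    funext i
    rw [eval_smul_of_isHomogeneous (hp i), pow_one]
    rfl
  · rw [mem_vanish, hα, eval_smul_of_isHomogeneous hf]
    exact mul_ne_zero (pow_ne_zero _ ha) hv1

theorem valueSet_subset_vanish {p : Fin 4 → MvPolynomial (Fin 4) ℂ} {f : MvPolynomial (Fin 4) ℂ}
    (hf : MvPolynomial.aeval p f = 0) : valueSet p ⊆ vanish f := by
  rintro α ⟨v, hv⟩
  rw [mem_vanish, hv, ← eval_aeval_eq, hf, map_zero]

/-- The polynomial ring is a domain: if neither of two equations pulls back to zero, some point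
violates both. -/
theorem isIrreducible_valueSet {p : Fin 4 → MvPolynomial (Fin 4) ℂ}
    (hp : ∀ i, (p i).IsHomogeneous 1) (hw : ∀ i, MvPolynomial.aeval p (weightPoly i) ≠ 0) :
    IsIrreducible (valueSet p) := by
  refine ⟨?_, ?_⟩
  · obtain ⟨α, hα, -⟩ := exists_mem_valueSet hp hw (MvPolynomial.isHomogeneous_one _ _)
      (by rw [map_one]; exact one_ne_zero)
    exact ⟨α, hα⟩
  · rw [isPreirreducible_iff_isClosed_union_isClosed]
    intro C C' hC hC' hCC'
    by_contra! h
    obtain ⟨α, hα, hαC⟩ := Set.not_subset.1 h.1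
    obtain ⟨β, hβ, hβC⟩ := Set.not_subset.1 h.2
    obtain ⟨f, d, hf, hfC, hfα⟩ := exists_vanish_of_notMem hC hαC
    obtain ⟨g, e, hg, hgC, hgβ⟩ := exists_vanish_of_notMem hC' hβC
    have hf0 : MvPolynomial.aeval p f ≠ 0 := fun h0 => hfα (valueSet_subset_vanish h0 hα)
    have hg0 : MvPolynomial.aeval p g ≠ 0 := fun h0 => hgβ (valueSet_subset_vanish h0 hβ)
    obtain ⟨γ, hγ, hγ'⟩ := exists_mem_valueSet hp hw (hf.mul hg)
      (by rw [map_mul]; exact mul_ne_zero hf0 hg0)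
    rw [mem_vanish, map_mul, mul_eq_zero, not_or] at hγ'
    exact (hCC' hγ).elim (fun h => hγ'.1 (hfC h)) fun h => hγ'.2 (hgC h)

theorem poly_ne_zero_of_eval {f : MvPolynomial (Fin 4) ℂ} (v : Fin 4 → ℂ)
    (h : MvPolynomial.eval v f ≠ 0) : f ≠ 0 := by
  rintro rfl
  exact h (map_zero _)

theorem isIrreducible_univ_U : IsIrreducible (Set.univ : Set U) := by
  have h := isIrreducible_valueSet (p := MvPolynomial.X) (fun i => MvPolynomial.isHomogeneous_X ℂ i)
    (fun i => by
      refine poly_ne_zero_of_eval (fun _ => 1) ?_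
      fin_cases i <;> simp [weightPoly]
      norm_num)
  convert h
  ext α
  simp only [valueSet, Set.mem_univ, true_iff, Set.mem_ofPred_eq, MvPolynomial.eval_X]
  exact ⟨α.1.coord, rfl⟩

/-- The parametrization of the hyperplane `P₁₂`. -/
def hyperplaneParam : Fin 4 → MvPolynomial (Fin 4) ℂ := ![.X 0, -.X 0, .X 2, .X 3]

theorem isHomogeneous_hyperplaneParam (i : Fin 4) : (hyperplaneParam i).IsHomogeneous 1 := by
  have h := fun j : Fin 4 => MvPolynomial.isHomogeneous_X ℂ j
  fin_cases i
  · exact h 0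
  · exact (h 0).neg
  · exact h 2
  · exact h 3

theorem aeval_hyperplaneParam_weightPoly_ne_zero (i : Fin 5) :
    MvPolynomial.aeval hyperplaneParam (weightPoly i) ≠ 0 := by
  refine poly_ne_zero_of_eval (fun _ => 1) ?_
  fin_cases i <;> simp [weightPoly, hyperplaneParam]

theorem P12_eq_valueSet : P12 = valueSet hyperplaneParam := by
  ext α
  rw [mem_P12_iff, U.weight, weight_zero, weight_one]
  constructor
  · intro h
    refine ⟨α.1.coord, ?_⟩
    funext i
    fin_cases i
    · simp [hyperplaneParam]
    · simpa [hyperplaneParam] using eq_neg_of_add_eq_zero_right h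
    · simp [hyperplaneParam]
    · simp [hyperplaneParam]
  · rintro ⟨v, hv⟩
    rw [hv]
    simp [hyperplaneParam]

theorem isIrreducible_P12 : IsIrreducible P12 := by
  rw [P12_eq_valueSet]
  exact isIrreducible_valueSet isHomogeneous_hyperplaneParam
    aeval_hyperplaneParam_weightPoly_ne_zero

/-- Modulo `X 0 + X 1` the substitution `hyperplaneParam` is the identity. -/
theorem dvd_of_aeval_hyperplaneParam_eq_zero {f : MvPolynomial (Fin 4) ℂ}
    (hf : MvPolynomial.aeval hyperplaneParam f = 0) :
    (MvPolynomial.X 0 + MvPolynomial.X 1 : MvPolynomial (Fin 4) ℂ) ∣ f := by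
  set I := Ideal.span {(MvPolynomial.X 0 + MvPolynomial.X 1 : MvPolynomial (Fin 4) ℂ)}
  have h : Ideal.Quotient.mkₐ ℂ I =
      (Ideal.Quotient.mkₐ ℂ I).comp (MvPolynomial.aeval hyperplaneParam) := by
    refine MvPolynomial.algHom_ext fun i => ?_
    rw [AlgHom.comp_apply, MvPolynomial.aeval_X]
    fin_cases i
    · rfl
    · refine Ideal.Quotient.eq.2 (Ideal.mem_span_singleton.2 ?_)
      simp [hyperplaneParam, ← add_comm (MvPolynomial.X (1 : Fin 4))]
    · rfl
    · rfl
  have h' := AlgHom.congr_fun h f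
  rw [AlgHom.comp_apply, hf, map_zero] at h'
  exact Ideal.mem_span_singleton.1 (Ideal.Quotient.eq_zero_iff_mem.1 h')

/-- The substitution of a permutation of the five coefficients. -/
def permPoly (σ : Equiv.Perm (Fin 5)) (f : MvPolynomial (Fin 4) ℂ) : MvPolynomial (Fin 4) ℂ :=
  MvPolynomial.aeval (fun j : Fin 4 => weightPoly (σ j.castSucc)) f

theorem eval_permPoly (σ : Equiv.Perm (Fin 5)) (f : MvPolynomial (Fin 4) ℂ) (c : Fin 4 → ℂ) :
    MvPolynomial.eval c (permPoly σ f) =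
      MvPolynomial.eval (fun j : Fin 4 => weight c (σ j.castSucc)) f := by
  rw [permPoly, eval_aeval_eq]
  simp only [eval_weightPoly]

theorem isHomogeneous_permPoly (σ : Equiv.Perm (Fin 5)) {f : MvPolynomial (Fin 4) ℂ} {d : ℕ}
    (hf : f.IsHomogeneous d) : (permPoly σ f).IsHomogeneous d := by
  have := hf.aeval (fun j : Fin 4 => weightPoly (σ j.castSucc)) fun j => isHomogeneous_weightPoly _
  rwa [one_mul] at this

theorem U.coord_eq (α : U) : α.1.coord = fun j : Fin 4 => α.weight j.castSucc := by
  funext j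
  rw [U.weight]
  fin_cases j
  · exact (weight_zero _).symm
  · exact (weight_one _).symm
  · exact (weight_two _).symm
  · exact (weight_three _).symm

/-- Both sides evaluate `f` at the same vector up to the factor `c`, which is harmless by
homogeneity. -/
theorem mem_vanish_permPoly_iff {α β : U} {σ τ : Equiv.Perm (Fin 5)} {c : ℂ} (hc : c ≠ 0)
    (h : ∀ i, β.weight (τ i) = c * α.weight (σ i)) {f : MvPolynomial (Fin 4) ℂ} {d : ℕ}
    (hf : f.IsHomogeneous d) : β ∈ vanish (permPoly τ f) ↔ α ∈ vanish (permPoly σ f) := by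
  rw [mem_vanish, mem_vanish, eval_permPoly, eval_permPoly]
  have : (fun j : Fin 4 => weight β.1.coord (τ j.castSucc)) =
      c • fun j : Fin 4 => weight α.1.coord (σ j.castSucc) := funext fun j => h _
  rw [this, eval_smul_of_isHomogeneous hf, mul_eq_zero, or_iff_right (pow_ne_zero _ hc)]

theorem vanish_permPoly_one (f : MvPolynomial (Fin 4) ℂ) : vanish (permPoly 1 f) = vanish f := by
  ext α
  rw [mem_vanish, mem_vanish, eval_permPoly]
  exact iff_of_eq (congrArg (fun c => MvPolynomial.eval c f = 0) α.coord_eq.symm)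

/-! ### Closedness and codimension in the quotient -/

theorem continuous_q : Continuous q := continuous_quotient_mk'

theorem surjective_q : Function.Surjective q := Quotient.mk_surjective

theorem isClosed_of_isClosed_preimage {Z : Set ModuliSpace} (h : IsClosed (q ⁻¹' Z)) : IsClosed Z :=
  (isQuotientMap_quotient_mk' (s := orbitSetoid)).isClosed_preimage.1 h

theorem isClosed_image_P12 : IsClosed (q '' P12) := by
  refine isClosed_of_isClosed_preimage ?_
  have h : q ⁻¹' (q '' P12) =
      ⋃ i : Fin 5, ⋃ j : Fin 5, ⋃ _ : i ≠ j, vanish (weightPoly i + weightPoly j) := by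
    ext α
    rw [Set.mem_preimage, q_mem_image_P12_iff]
    simp [mem_vanish, eval_weightPoly, U.weight]
  rw [h]
  exact isClosed_iUnion_of_finite fun i => isClosed_iUnion_of_finite fun j =>
    isClosed_iUnion_of_finite fun _ =>
      isClosed_vanish ((isHomogeneous_weightPoly i).add (isHomogeneous_weightPoly j))

/-- The locus of the special configurations has codimension one. -/
theorem eq_or_eq_univ_of_image_P12_subset {Z : Set ModuliSpace} (hZ : IsClosed Z)
    (hZi : IsIrreducible Z) (hsub : q '' P12 ⊆ Z) : Z = q '' P12 ∨ Z = Set.univ := by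
  by_contra! hne
  obtain ⟨z, hz⟩ := (Set.ne_univ_iff_exists_notMem Z).1 hne.2
  obtain ⟨α, rfl⟩ := surjective_q z
  obtain ⟨f, d, hf, hfZ, hfα⟩ := exists_vanish_of_notMem (hZ.preimage continuous_q) hz
  have hf0 : f ≠ 0 := by
    rintro rfl
    exact hfα (map_zero _)
  let l : MvPolynomial (Fin 4) ℂ := MvPolynomial.X 0 + MvPolynomial.X 1
  have hl : l.IsHomogeneous 1 :=
    (MvPolynomial.isHomogeneous_X ℂ 0).add (MvPolynomial.isHomogeneous_X ℂ 1)
  have hlu : ¬ IsUnit l := by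
    intro hu
    have := hu.map (MvPolynomial.eval (0 : Fin 4 → ℂ))
    simp [l] at this
  -- All factors `l` are removed from `f`; the cofactor `h` still vanishes wherever `f` does outside
  -- `P12`, but not on all of `P12`.
  obtain ⟨h, hfh, hlh⟩ := (FiniteMultiplicity.of_not_isUnit hlu hf0).exists_eq_pow_mul_and_not_dvd
  set k := multiplicity l f
  have hh : h.IsHomogeneous (d - 1 * k) :=
    isHomogeneous_of_mul_left (hl.pow k) (hfh ▸ hf) (hfh ▸ hf0)
  -- The planes whose whole orbit lies in `vanish h`; this set is saturated, so its image is closed.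
  let K : Set U := ⋂ σ : Equiv.Perm (Fin 5), vanish (permPoly σ h)
  have hK : IsClosed K := isClosed_iInter fun σ => isClosed_vanish (isHomogeneous_permPoly σ hh)
  have hKq : q ⁻¹' (q '' K) = K := by
    refine Set.Subset.antisymm ?_ (Set.subset_preimage_image q K)
    rintro β ⟨γ, hγ, hq⟩
    obtain ⟨τ, c, hc, hτ⟩ := (q_eq_iff γ β).1 hq
    refine Set.mem_iInter.2 fun σ => ?_
    refine (mem_vanish_permPoly_iff (α := γ) (σ := τ⁻¹ * σ) hc (fun i => ?_) hh).2
      (Set.mem_iInter.1 hγ _)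
    rw [← hτ, Equiv.Perm.mul_apply]
    exact congrArg β.weight (τ.apply_symm_apply (σ i)).symm
  have hKc : IsClosed (q '' K) := isClosed_of_isClosed_preimage (by rwa [hKq])
  -- If an orbit in `Z` misses `P12`, then `f` vanishes and `l` does not on each of its planes, so
  -- `h` vanishes on the whole orbit.
  have hcover : Z ⊆ q '' P12 ∪ q '' K := by
    intro z hz
    obtain ⟨β, rfl⟩ := surjective_q z
    refine or_iff_not_imp_left.2 fun hβ => ⟨β, Set.mem_iInter.2 fun σ => ?_, rfl⟩
    obtain ⟨γ, a, ha, hγ⟩ := U.exists_weight_eq (s := β.weight ∘ σ)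
      (fun i => β.weight_ne_zero _) (by rw [← β.sum_weight]; exact Equiv.sum_comp σ β.weight)
    have hq : q γ = q β := (q_eq_iff γ β).2 ⟨σ, a⁻¹, inv_ne_zero ha, fun i => by
      rw [hγ, inv_mul_cancel_left₀ ha, Function.comp_apply]⟩
    have hγf : γ ∈ vanish f := hfZ (by rwa [Set.mem_preimage, hq])
    have hγl : γ ∉ P12 := fun h' => hβ ⟨γ, h', hq⟩
    rw [mem_P12_iff, U.weight, weight_zero, weight_one] at hγl
    rw [mem_vanish, hfh, map_mul, map_pow, mul_eq_zero] at hγf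
    have hγh : γ ∈ vanish h := hγf.resolve_left (pow_ne_zero _ (by simpa [l] using hγl))
    rw [← vanish_permPoly_one] at hγh
    exact (mem_vanish_permPoly_iff ha (fun i => hγ i) hh).1 hγh
  obtain h1 | h1 := isPreirreducible_iff_isClosed_union_isClosed.1 hZi.2 _ _ isClosed_image_P12 hKc
    hcover
  · exact hne.1 (h1.antisymm hsub)
  · have hP : P12 ⊆ vanish h := by
      intro β hβ
      have : β ∈ K := hKq ▸ (h1 (hsub (Set.mem_image_of_mem q hβ)) : β ∈ q ⁻¹' (q '' K))
      rw [← vanish_permPoly_one]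
      exact Set.mem_iInter.1 this 1
    have hh0 : MvPolynomial.aeval hyperplaneParam h ≠ 0 := fun h0 =>
      hlh (dvd_of_aeval_hyperplaneParam_eq_zero h0)
    obtain ⟨β, hβ, hβ'⟩ := exists_mem_valueSet isHomogeneous_hyperplaneParam
      aeval_hyperplaneParam_weightPoly_ne_zero hh hh0
    rw [← P12_eq_valueSet] at hβ
    exact hβ' (hP hβ)

theorem image_P12_ne_univ : q '' P12 ≠ Set.univ := by
  intro h
  -- Nonzero weights of sum zero, no two of which cancel.
  obtain ⟨α, a, ha, hα⟩ := U.exists_weight_eq (s := ![1, 1, 1, 1, -4])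
    (fun i => by fin_cases i <;> simp) (by simp [Fin.sum_univ_five]; norm_num)
  obtain ⟨i, j, hij, h0⟩ := (q_mem_image_P12_iff α).1 (h ▸ Set.mem_univ _)
  rw [hα, hα, ← mul_add] at h0
  have := (mul_eq_zero.1 h0).resolve_left ha
  fin_cases i <;> fin_cases j <;> first | exact hij rfl | (norm_num at this)

/-- Only the whole space lies strictly above `q '' P12`, and it is itself irreducible, so the
coheight is exactly 1. -/
theorem isIrreducibleDivisor_image_P12 : IsIrreducibleDivisor (q '' P12) := by
  refine ⟨⟨q '' P12, isIrreducible_P12.image q continuous_q.continuousOn, isClosed_image_P12⟩, rfl,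
    le_antisymm ?_ ?_⟩
  · rw [← Nat.cast_one, Order.coheight_le_coe_iff]
    intro Z hZ
    have hZu : (Z : Set ModuliSpace) = Set.univ :=
      (eq_or_eq_univ_of_image_P12_subset Z.isClosed Z.isIrreducible
        (SetLike.coe_subset_coe.2 hZ.le)).resolve_left fun h =>
          hZ.ne (SetLike.coe_injective h.symm)
    have hmax : IsMax Z := fun Z' _ => by
      rw [← SetLike.coe_subset_coe, hZu]
      exact Set.subset_univ _
    rw [Order.coheight_eq_zero.2 hmax]
    exact one_pos
  · rw [Order.one_le_iff_ne_zero, Order.coheight_ne_zero]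
    intro hmax
    have huniv : IsIrreducible (Set.univ : Set ModuliSpace) := by
      rw [← surjective_q.range_eq, ← Set.image_univ]
      exact isIrreducible_univ_U.image q continuous_q.continuousOn
    have := hmax (b := ⟨Set.univ, huniv, isClosed_univ⟩)
      (SetLike.coe_subset_coe.1 (Set.subset_univ _))
    exact image_P12_ne_univ (Set.univ_subset_iff.1 (SetLike.coe_subset_coe.2 this))

end DesarguesModuli

end

theorem mainTheorem11 :
    -- `q(P₁₂)` is an irreducible divisor of `M_D`
    DesarguesModuli.IsIrreducibleDivisor (DesarguesModuli.q '' DesarguesModuli.P12) ∧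
    -- it is the locus of the special configurations
    (∀ α : DesarguesModuli.U,
      (DesarguesModuli.desargues α).IsSpecialDesargues ↔
        DesarguesModuli.q α ∈ DesarguesModuli.q '' DesarguesModuli.P12) ∧
    -- every special Desargues configuration in the projective plane occurs
    (∀ D : DesarguesModuli.Configuration (Fin 3 → ℂ), D.IsSpecialDesargues →
      ∃ α ∈ DesarguesModuli.P12, D.Iso (DesarguesModuli.desargues α)) ∧
    -- and its isomorphism class is determined by its point in `q(P₁₂)`, and conversely
    (∀ α ∈ DesarguesModuli.P12, ∀ β ∈ DesarguesModuli.P12,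
      (DesarguesModuli.desargues α).Iso (DesarguesModuli.desargues β) ↔
        DesarguesModuli.q α = DesarguesModuli.q β) := by
  exact ⟨DesarguesModuli.isIrreducibleDivisor_image_P12,
    fun α => (DesarguesModuli.isSpecialDesargues_desargues_iff α).trans
      (DesarguesModuli.q_mem_image_P12_iff α).symm,
    fun _ hD => DesarguesModuli.exists_iso_desargues hD,
    fun α _ β _ => DesarguesModuli.iso_desargues_iff α β⟩
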